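/- **Theorem 2 (Fortin interpolation error).** Let $0<\alpha\le 1$ and $\arccos(\alpha/2)\le\theta<\pi$, and let $T_{\alpha,\theta}$ be the open triangle with vertices $O=(0,0)$, $A=(1,0)$, $B=(\alpha\cos\theta,\alpha\sin\theta)$ and edges $e_1=OA$, $e_2=OB$, $e_3=AB$. Write $\|\cdot\|$ for the norm of $L^2(T_{\alpha,\theta})$ or $L^2(T_{\alpha,\theta})^2$ and $|\cdot|_1$ for the seminorm of $H^1(T_{\alpha,\theta})$ or $H^1(T_{\alpha,\theta})^2$ (the $L^2$ norm of the weak gradient); values on edges are understood as traces. For $i=1,2$ put $$C_i(\alpha,\theta)=\sup\Big\{\frac{\|v\|}{|v|_1}\;:\;v\in H^1(T_{\alpha,\theta})\setminus\{0\},\ \int_{e_i}v\,ds=0\Big\},$$ and, with $c_i=C_i(\alpha,\theta)$, $$C_6(\alpha,\theta)=\frac{\Big\{c_1^2+c_2^2+2c_1c_2\cos^2\theta+(c_1+c_2)\sqrt{c_1^2+c_2^2+2c_1c_2\cos2\theta}\Big\}^{1/2}}{\sqrt2\,\sin\theta}.$$ For $q\in H^1(T_{\alpha,\theta})^2$ let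 the lowest-order Raviart–Thomas (Fortin) interpolant $\Pi^F_{\alpha,\theta}q$ be the field of the form $(a_1+a_3x_1,\,a_2+a_3x_2)$ with constants $a_1,a_2,a_3\in\mathbb R$ such that $$\int_{e_i}(\Pi^F_{\alpha,\theta}q-q)\cdot n\,ds=0\qquad(i=1,2,3),$$ where $n$ is the outward unit normal. Then $C_1(\alpha,\theta)$ and $C_2(\alpha,\theta)$ are finite, for every $q\in H^1(T_{\alpha,\theta})^2$ the interpolant $\Pi^F_{\alpha,\theta}q$ exists and is unique, and $$\|q-\Pi^F_{\alpha,\theta}q\|\le C_6(\alpha,\theta)\,|q|_1 .$$ -/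

import Mathlib

open MeasureTheory

/-! The plane is `ℝ × ℝ` with Lebesgue measure. Its (sup) norm instance is never used: Euclidean
lengths, unit normals and `L²` norms of vector fields are written out in coordinates. -/

noncomputable section

/-- The open triangle with vertices `P`, `Q`, `R`. -/
def openTriangle (P Q R : ℝ × ℝ) : Set (ℝ × ℝ) :=
  {x | ∃ a b c : ℝ, 0 < a ∧ 0 < b ∧ 0 < c ∧ a + b + c = 1 ∧ x = a • P + b • Q + c • R}

/-- The vertex `A = (1, 0)` of `T_{α,θ}`. -/
def vertexA : ℝ × ℝ := (1, 0)

/-- The vertex `B = (α cos θ, α sin θ)` of `T_{α,θ}`. -/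
def vertexB (α θ : ℝ) : ℝ × ℝ := (α * Real.cos θ, α * Real.sin θ)

/-- `T_{α,θ}`: the open triangle `OAB`. -/
def triangleT (α θ : ℝ) : Set (ℝ × ℝ) := openTriangle 0 vertexA (vertexB α θ)

/-- First end points of the edges `e₁ = OA`, `e₂ = BO`, `e₃ = AB` (indices `0, 1, 2`); the edges are
traversed counterclockwise. -/
def edgeStart (α θ : ℝ) : Fin 3 → ℝ × ℝ := ![0, vertexB α θ, vertexA]

/-- Second end points of the edges `e₁ = OA`, `e₂ = BO`, `e₃ = AB`. -/
def edgeEnd (α θ : ℝ) : Fin 3 → ℝ × ℝ := ![vertexA, 0, vertexB α θ]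

/-- Euclidean length of the `i`-th edge. -/
def edgeLength (α θ : ℝ) (i : Fin 3) : ℝ :=
  Real.sqrt (((edgeEnd α θ i).1 - (edgeStart α θ i).1) ^ 2
    + ((edgeEnd α θ i).2 - (edgeStart α θ i).2) ^ 2)

/-- Outward unit normal on the `i`-th edge: the unit tangent turned clockwise by `π / 2`. -/
def edgeNormal (α θ : ℝ) (i : Fin 3) : ℝ × ℝ :=
  (((edgeEnd α θ i).2 - (edgeStart α θ i).2) / edgeLength α θ i,
    -((edgeEnd α θ i).1 - (edgeStart α θ i).1) / edgeLength α θ i)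

/-- Affine parametrization of the `i`-th edge by `[0, 1]`. -/
def edgePoint (α θ : ℝ) (i : Fin 3) (t : ℝ) : ℝ × ℝ :=
  edgeStart α θ i + t • (edgeEnd α θ i - edgeStart α θ i)

/-- The `L²(U)` norm of a scalar function (meaningful for `v ∈ L²(U)`). -/
def l2Norm (U : Set (ℝ × ℝ)) (v : ℝ × ℝ → ℝ) : ℝ :=
  Real.sqrt (∫ x in U, v x ^ 2)

/-- The `L²(U)²` norm of a vector field. -/
def l2NormVec (U : Set (ℝ × ℝ)) (q : ℝ × ℝ → ℝ × ℝ) : ℝ :=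
  Real.sqrt (∫ x in U, ((q x).1 ^ 2 + (q x).2 ^ 2))

/-- `d ∈ L²(U)` is the weak derivative of `v` on the open set `U` in the direction `e`. -/
def IsWeakDeriv (U : Set (ℝ × ℝ)) (e : ℝ × ℝ) (v d : ℝ × ℝ → ℝ) : Prop :=
  MemLp d 2 (volume.restrict U) ∧
    ∀ φ : ℝ × ℝ → ℝ, ContDiff ℝ (⊤ : ℕ∞) φ → HasCompactSupport φ → tsupport φ ⊆ U →
      ∫ x in U, v x * fderiv ℝ φ x e = - ∫ x in U, d x * φ x

/-- The Sobolev space `H¹(U)`. -/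
def MemH1 (U : Set (ℝ × ℝ)) (v : ℝ × ℝ → ℝ) : Prop :=
  MemLp v 2 (volume.restrict U) ∧
    (∃ d, IsWeakDeriv U (1, 0) v d) ∧ (∃ d, IsWeakDeriv U (0, 1) v d)

open Classical in
/-- The weak derivative (unique up to null sets), and `0` if there is none in `L²(U)`. -/
def weakDeriv (U : Set (ℝ × ℝ)) (e : ℝ × ℝ) (v : ℝ × ℝ → ℝ) : ℝ × ℝ → ℝ :=
  if h : ∃ d, IsWeakDeriv U e v d then h.choose else 0

/-- The seminorm `|v|₁` on `H¹(U)`. -/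
def h1Semi (U : Set (ℝ × ℝ)) (v : ℝ × ℝ → ℝ) : ℝ :=
  Real.sqrt (∫ x in U, (weakDeriv U (1, 0) v x ^ 2 + weakDeriv U (0, 1) v x ^ 2))

/-- The seminorm `|q|₁` on `H¹(U)²`. -/
def h1SemiVec (U : Set (ℝ × ℝ)) (q : ℝ × ℝ → ℝ × ℝ) : ℝ :=
  Real.sqrt (h1Semi U (fun x => (q x).1) ^ 2 + h1Semi U (fun x => (q x).2) ^ 2)

/-- `g ∈ L²(0, 1)` is the trace of `v ∈ H¹(T_{α,θ})` on the `i`-th edge, read in the parameter of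
`edgePoint`: the trace is the continuous extension to `H¹` of the restriction of smooth functions,
so some sequence of functions smooth up to the boundary tends to `v` in `H¹(T_{α,θ})` while its
restrictions to the edge tend to `g` in `L²`. -/
def IsTrace (α θ : ℝ) (i : Fin 3) (v : ℝ × ℝ → ℝ) (g : ℝ → ℝ) : Prop :=
  MemH1 (triangleT α θ) v ∧ MemLp g 2 (volume.restrict (Set.Ioc 0 1)) ∧
    ∃ φ : ℕ → ℝ × ℝ → ℝ, (∀ n, ContDiff ℝ (⊤ : ℕ∞) (φ n)) ∧
      Filter.Tendsto (fun n => l2Norm (triangleT α θ) (fun x => v x - φ n x))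
        Filter.atTop (nhds 0) ∧
      (∀ e ∈ ({(1, 0), (0, 1)} : Set (ℝ × ℝ)),
        Filter.Tendsto (fun n => l2Norm (triangleT α θ)
          (fun x => weakDeriv (triangleT α θ) e v x - fderiv ℝ (φ n) x e))
          Filter.atTop (nhds 0)) ∧
      Filter.Tendsto (fun n => ∫ t in (0 : ℝ)..1, (g t - φ n (edgePoint α θ i t)) ^ 2)
        Filter.atTop (nhds 0)

/-- `∫_{e_i} v ds = I`, for `v ∈ H¹(T_{α,θ})` in the sense of traces. -/
def HasEdgeIntegral (α θ : ℝ) (i : Fin 3) (v : ℝ × ℝ → ℝ) (I : ℝ) : Prop :=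
  ∃ g : ℝ → ℝ, IsTrace α θ i v g ∧ edgeLength α θ i * ∫ t in (0 : ℝ)..1, g t = I

/-- The quotients `‖v‖ / |v|₁` for nonzero `v ∈ H¹(T_{α,θ})` with `∫_{e_i} v ds = 0`. -/
def edgeQuotients (α θ : ℝ) (i : Fin 3) : Set ℝ :=
  {r | ∃ v : ℝ × ℝ → ℝ, MemH1 (triangleT α θ) v ∧ HasEdgeIntegral α θ i v 0 ∧
    ¬ v =ᵐ[volume.restrict (triangleT α θ)] 0 ∧
    r = l2Norm (triangleT α θ) v / h1Semi (triangleT α θ) v}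

/-- The constant `C_{i+1}(α, θ)`: index `0` is the edge `e₁ = OA`, index `1` the edge `e₂ = OB`. -/
def edgeConst (α θ : ℝ) (i : Fin 3) : ℝ := sSup (edgeQuotients α θ i)

/-- The expression `C₆` in terms of `c₁`, `c₂` and `θ`. -/
def c6Expr (c₁ c₂ θ : ℝ) : ℝ :=
  Real.sqrt (c₁ ^ 2 + c₂ ^ 2 + 2 * c₁ * c₂ * Real.cos θ ^ 2
      + (c₁ + c₂) * Real.sqrt (c₁ ^ 2 + c₂ ^ 2 + 2 * c₁ * c₂ * Real.cos (2 * θ)))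
    / (Real.sqrt 2 * Real.sin θ)

/-- The constant `C₆(α, θ)`. -/
def constC6 (α θ : ℝ) : ℝ := c6Expr (edgeConst α θ 0) (edgeConst α θ 1) θ

/-- The lowest-order Raviart–Thomas field `(a₁ + a₃ x₁, a₂ + a₃ x₂)`. -/
def rtField (a : ℝ × ℝ × ℝ) (x : ℝ × ℝ) : ℝ × ℝ := (a.1 + a.2.2 * x.1, a.2.1 + a.2.2 * x.2)

/-- `rtField a` is the Fortin interpolant of `q`: `∫_{e_i} (rtField a - q) · n ds = 0` on every
edge. -/
def IsFortinInterpolant (α θ : ℝ) (q : ℝ × ℝ → ℝ × ℝ) (a : ℝ × ℝ × ℝ) : Prop :=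
  ∀ i : Fin 3, HasEdgeIntegral α θ i
    (fun x => ((rtField a x).1 - (q x).1) * (edgeNormal α θ i).1
      + ((rtField a x).2 - (q x).2) * (edgeNormal α θ i).2) 0

end

/-! Let r = Πq - q, and let u = r·n₁ and w = r·n₂ be its components along the normals of e₁ and e₂.
Both have mean zero on their edge, so ‖u‖ ≤ c₁|u|₁ and ‖w‖ ≤ c₂|w|₁. Since n₁·n₂ = -cos θ, the
identity sin²θ |r|² = u² + w² + 2 cos θ u w holds pointwise, and likewise for each partial
derivative of r. With a = |u|₁, b = |w|₁ and k = |cos θ|, Cauchy–Schwarz on the cross terms gives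
sin²θ ‖r‖² ≤ c₁²a² + c₂²b² + 2k c₁c₂ab and sin²θ |r|₁² ≥ a² + b² - 2k ab. The best constant between
these two quadratic forms is C₆², the larger root of a 2×2 generalized eigenvalue problem
(`form_le_c6Expr_sq_mul`, used in `l2_sq_le_c6_sq_mul`). Finally |r|₁ ≤ |q|₁: the gradient of Πq is
a₃ times the identity, and a₃ is half the mean of div q, so subtracting it is an orthogonal
projection (`IsFortinInterpolant.h1Semi_sq_le`).

The analytic work is to make edge integrals of H¹ functions usable. The divergence theorem for φ(x -
P), with P the vertex opposite the edge, turns the edge mean of a smooth φ into an area integral of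
φ and its gradient (`integral_openTriangle_fderiv`). That integral makes sense on all of H¹ and is
`edgeFunctional`. Density of smooth functions (`exists_contDiff_tendsto`) and a trace inequality
identify it with the edge integral of the trace (`hasEdgeIntegral_iff`). Existence and uniqueness of
the interpolant then become a 3×3 linear system, and finiteness of c₁, c₂ is a Poincaré inequality
(`exists_poincare`) obtained from an oscillation bound on convex sets. -/

/-! ### Square integrable functions -/

section L2

variable {X : Type*} [MeasurableSpace X] {μ : Measure X}

/-- Bridge from explicit square-root integrals to the Hilbert space `Lp`, from which Cauchy–Schwarz,
the triangle inequality and completeness are imported. -/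
theorem sqrt_integral_sq_eq_norm_toLp {f : X → ℝ} (hf : MemLp f 2 μ) :
    Real.sqrt (∫ x, f x ^ 2 ∂μ) = ‖hf.toLp f‖ := by
  rw [norm_eq_sqrt_real_inner, L2.inner_def]
  congr 1
  refine integral_congr_ae ?_
  filter_upwards [hf.coeFn_toLp] with x hx
  simp [hx, sq]

theorem integral_mul_eq_inner_toLp {f g : X → ℝ} (hf : MemLp f 2 μ) (hg : MemLp g 2 μ) :
    ∫ x, f x * g x ∂μ = inner ℝ (hf.toLp f) (hg.toLp g) := by
  rw [L2.inner_def]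
  refine integral_congr_ae ?_
  filter_upwards [hf.coeFn_toLp, hg.coeFn_toLp] with x hx hy
  simp [hx, hy, mul_comm]

theorem abs_integral_mul_le_sqrt {f g : X → ℝ} (hf : MemLp f 2 μ) (hg : MemLp g 2 μ) :
    |∫ x, f x * g x ∂μ| ≤ Real.sqrt (∫ x, f x ^ 2 ∂μ) * Real.sqrt (∫ x, g x ^ 2 ∂μ) := by
  rw [integral_mul_eq_inner_toLp hf hg, sqrt_integral_sq_eq_norm_toLp hf,
    sqrt_integral_sq_eq_norm_toLp hg]
  exact abs_real_inner_le_norm _ _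

theorem sqrt_integral_sq_eq_toReal_eLpNorm {f : X → ℝ} (hf : MemLp f 2 μ) :
    Real.sqrt (∫ x, f x ^ 2 ∂μ) = (eLpNorm f 2 μ).toReal := by
  rw [sqrt_integral_sq_eq_norm_toLp hf, Lp.norm_toLp]

theorem sqrt_integral_sq_add_le {f g : X → ℝ} (hf : MemLp f 2 μ) (hg : MemLp g 2 μ) :
    Real.sqrt (∫ x, (f x + g x) ^ 2 ∂μ)
      ≤ Real.sqrt (∫ x, f x ^ 2 ∂μ) + Real.sqrt (∫ x, g x ^ 2 ∂μ) := by
  have h := sqrt_integral_sq_eq_norm_toLp (hf.add hg)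
  simp only [Pi.add_apply] at h
  rw [h, sqrt_integral_sq_eq_norm_toLp hf, sqrt_integral_sq_eq_norm_toLp hg, MemLp.toLp_add]
  exact norm_add_le _ _

theorem tendsto_integral_mul_of_tendsto_sqrt_integral_sq {ι : Type*} {l : Filter ι} {w f : X → ℝ}
    {φ : ι → X → ℝ} (hw : MemLp w 2 μ) (hf : MemLp f 2 μ) (hφ : ∀ n, MemLp (φ n) 2 μ)
    (h : Filter.Tendsto (fun n => Real.sqrt (∫ x, (f x - φ n x) ^ 2 ∂μ)) l (nhds 0)) :
    Filter.Tendsto (fun n => ∫ x, w x * φ n x ∂μ) l (nhds (∫ x, w x * f x ∂μ)) := by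
  rw [tendsto_iff_norm_sub_tendsto_zero]
  refine squeeze_zero (fun _ => norm_nonneg _) (fun n => ?_)
    (by simpa using h.const_mul (Real.sqrt (∫ x, w x ^ 2 ∂μ)))
  have h2 := abs_integral_mul_le_sqrt hw (hf.sub (hφ n))
  simp only [Pi.sub_apply, mul_sub] at h2
  rw [integral_sub (f := fun x => w x * f x) (g := fun x => w x * φ n x)
    (hw.integrable_mul hf) (hw.integrable_mul (hφ n))] at h2
  rwa [Real.norm_eq_abs, abs_sub_comm]

theorem tendsto_sqrt_integral_sq_of_tendsto {ι : Type*} {l : Filter ι} {f : X → ℝ}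
    {φ : ι → X → ℝ} (hf : MemLp f 2 μ) (hφ : ∀ n, MemLp (φ n) 2 μ)
    (h : Filter.Tendsto (fun n => Real.sqrt (∫ x, (f x - φ n x) ^ 2 ∂μ)) l (nhds 0)) :
    Filter.Tendsto (fun n => Real.sqrt (∫ x, φ n x ^ 2 ∂μ)) l
      (nhds (Real.sqrt (∫ x, f x ^ 2 ∂μ))) := by
  rw [tendsto_iff_norm_sub_tendsto_zero]
  refine squeeze_zero (fun _ => norm_nonneg _) (fun n => ?_) h
  have h1 := sqrt_integral_sq_eq_norm_toLp (hf.sub (hφ n))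
  simp only [Pi.sub_apply] at h1
  rw [h1, MemLp.toLp_sub hf (hφ n), sqrt_integral_sq_eq_norm_toLp hf,
    sqrt_integral_sq_eq_norm_toLp (hφ n), norm_sub_rev (MemLp.toLp f hf)]
  exact abs_norm_sub_norm_le _ _

/-- Completeness of `L²`. -/
theorem exists_tendsto_sqrt_integral_sq {φ : ℕ → X → ℝ} (hφ : ∀ n, MemLp (φ n) 2 μ)
    {B : ℕ → ℝ} (hB : Filter.Tendsto B Filter.atTop (nhds 0))
    (h : ∀ n m, Real.sqrt (∫ x, (φ n x - φ m x) ^ 2 ∂μ) ≤ B n + B m) :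
    ∃ f, MemLp f 2 μ ∧
      Filter.Tendsto (fun n => ∫ x, (f x - φ n x) ^ 2 ∂μ) Filter.atTop (nhds 0) := by
  have hC : CauchySeq fun n => (hφ n).toLp (φ n) := by
    rw [Metric.cauchySeq_iff]
    intro ε hε
    have h1 := (hB.eventually (gt_mem_nhds (half_pos hε)))
    obtain ⟨N, hN⟩ := Filter.eventually_atTop.1 h1
    refine ⟨N, fun m hm n hn => ?_⟩
    have h2 := sqrt_integral_sq_eq_norm_toLp ((hφ m).sub (hφ n))
    simp only [Pi.sub_apply] at h2
    rw [dist_eq_norm, ← MemLp.toLp_sub, ← h2]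
    linarith [h m n, hN m hm, hN n hn]
  obtain ⟨F, hF⟩ := cauchySeq_tendsto_of_complete hC
  refine ⟨F, Lp.memLp F, ?_⟩
  have h3 := (tendsto_iff_norm_sub_tendsto_zero.1 hF).pow 2
  simp only [ne_eq, OfNat.ofNat_ne_zero, not_false_eq_true, zero_pow] at h3
  refine h3.congr fun n => ?_
  have h2 := sqrt_integral_sq_eq_norm_toLp ((Lp.memLp F).sub (hφ n))
  rw [MemLp.toLp_sub (Lp.memLp F) (hφ n), Lp.toLp_coeFn, norm_sub_rev] at h2
  rw [← h2, Real.sq_sqrt (integral_nonneg fun _ => sq_nonneg _)]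
  rfl

theorem lintegral_mul_sq_le {f g : X → ENNReal} (hf : AEMeasurable f μ) (hg : AEMeasurable g μ) :
    (∫⁻ x, f x * g x ∂μ) ^ 2 ≤ (∫⁻ x, f x ^ 2 ∂μ) * ∫⁻ x, g x ^ 2 ∂μ := by
  have h := ENNReal.lintegral_mul_le_Lp_mul_Lq μ Real.HolderConjugate.two_two hf hg
  simp only [Pi.mul_apply, ENNReal.rpow_two] at h
  refine (pow_le_pow_left₀ zero_le h 2).trans_eq ?_
  rw [mul_pow, ← ENNReal.rpow_two, ← ENNReal.rpow_two, ← ENNReal.rpow_mul, ← ENNReal.rpow_mul]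
  norm_num

theorem eLpNorm_two_sq (f : X → ℝ) : eLpNorm f 2 μ ^ 2 = ∫⁻ x, ‖f x‖ₑ ^ 2 ∂μ := by
  rw [eLpNorm_eq_lintegral_rpow_enorm_toReal two_ne_zero ENNReal.ofNat_ne_top,
    ← ENNReal.rpow_two, ← ENNReal.rpow_mul]
  norm_num

end L2

theorem lintegral_comp_smul_add {F : ℝ × ℝ → ENNReal} (hF : Measurable F) {c : ℝ} (hc : c ≠ 0)
    (b : ℝ × ℝ) : ∫⁻ x, F (c • x + b) = ENNReal.ofReal ((c ^ 2)⁻¹) * ∫⁻ x, F x := by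
  have h1 : ∫⁻ x : ℝ × ℝ, F (c • x + b) = ∫⁻ y, F (y + b) ∂(Measure.map (c • ·) volume) := by
    rw [lintegral_map (by fun_prop) (by fun_prop)]
  rw [h1, Measure.map_addHaar_smul _ hc, lintegral_smul_measure, lintegral_add_right_eq_self F b,
    smul_eq_mul]
  simp [abs_of_nonneg (sq_nonneg c)]

/-! ### Smooth functions are dense in `H¹` of a bounded convex open set -/

section Density

/-- The average of `f` over the points `(1 - ε) x + ε z`, where `z` has weight `ρ z`. -/
noncomputable def dilatedAverage (ρ : ℝ × ℝ → ℝ) (ε : ℝ) (f : ℝ × ℝ → ℝ) (x : ℝ × ℝ) : ℝ :=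
  ∫ z, ρ z * f ((1 - ε) • x + ε • z)

theorem memLp_comp_smul_add {h : ℝ × ℝ → ℝ} (hm : Measurable h) (h2 : MemLp h 2 volume) {c : ℝ}
    (hc : c ≠ 0) (b : ℝ × ℝ) : MemLp (fun z => h (b + c • z)) 2 volume := by
  refine ⟨(by fun_prop : Measurable fun z => h (b + c • z)).aestronglyMeasurable, ?_⟩
  have h1 : eLpNorm (fun z => h (b + c • z)) 2 volume ^ 2
      = ENNReal.ofReal ((c ^ 2)⁻¹) * eLpNorm h 2 volume ^ 2 := by
    rw [eLpNorm_two_sq, eLpNorm_two_sq,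
      ← lintegral_comp_smul_add (F := fun x => ‖h x‖ₑ ^ 2) (by fun_prop) hc b]
    simp only [add_comm]
  have h3 : eLpNorm (fun z => h (b + c • z)) 2 volume ^ 2 < ⊤ := by
    rw [h1]
    exact ENNReal.mul_lt_top ENNReal.ofReal_lt_top (ENNReal.pow_lt_top h2.2)
  by_contra hcon
  rw [not_lt_top_iff] at hcon
  simp [hcon] at h3

theorem integrable_dilatedAverage {ρ h : ℝ × ℝ → ℝ} (hρ : MemLp ρ 2 volume) (hm : Measurable h)
    (h2 : MemLp h 2 volume) {ε : ℝ} (hε : ε ≠ 0) (x : ℝ × ℝ) :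
    Integrable (fun z => ρ z * h ((1 - ε) • x + ε • z)) :=
  hρ.integrable_mul (memLp_comp_smul_add hm h2 hε _)

theorem dilatedAverage_sub {ρ f g : ℝ × ℝ → ℝ} (hρ : MemLp ρ 2 volume) (hf : Measurable f)
    (hf2 : MemLp f 2 volume) (hg : Measurable g) (hg2 : MemLp g 2 volume) {ε : ℝ} (hε : ε ≠ 0)
    (x : ℝ × ℝ) :
    dilatedAverage ρ ε (f - g) x = dilatedAverage ρ ε f x - dilatedAverage ρ ε g x := by
  unfold dilatedAverage
  rw [← integral_sub (integrable_dilatedAverage hρ hf hf2 hε x)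
    (integrable_dilatedAverage hρ hg hg2 hε x)]
  simp [mul_sub]

/-- Cauchy–Schwarz in z splits off ρ. After exchanging the integrals, x ↦ (1 - ε)x + εz is for fixed
z a dilation of the plane, which costs the factor (1 - ε)⁻². The bound is uniform for small ε. -/
theorem eLpNorm_dilatedAverage_sq_le {U : Set (ℝ × ℝ)} (hU : MeasurableSet U) {ρ h : ℝ × ℝ → ℝ}
    (hρ : Measurable ρ) (hρU : Function.support ρ ⊆ U) (hm : Measurable h) {ε : ℝ} (hε1 : ε < 1) :
    eLpNorm (dilatedAverage ρ ε h) 2 volume ^ 2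
      ≤ eLpNorm ρ 2 volume ^ 2 * (volume U * (ENNReal.ofReal (((1 - ε) ^ 2)⁻¹)
        * eLpNorm h 2 volume ^ 2)) := by
  have hpt : ∀ x, ‖dilatedAverage ρ ε h x‖ₑ ^ 2
      ≤ eLpNorm ρ 2 volume ^ 2 * ∫⁻ z in U, ‖h ((1 - ε) • x + ε • z)‖ₑ ^ 2 := by
    intro x
    have h1 : ‖dilatedAverage ρ ε h x‖ₑ ≤ ∫⁻ z in U, ‖ρ z‖ₑ * ‖h ((1 - ε) • x + ε • z)‖ₑ := by
      refine (enorm_integral_le_lintegral_enorm _).trans_eq ?_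
      rw [← lintegral_indicator hU]
      refine lintegral_congr fun z => ?_
      by_cases hz : z ∈ U
      · simp [hz, enorm_mul]
      · have : ρ z = 0 := by
          by_contra h0
          exact hz (hρU h0)
        simp [hz, this]
    refine (pow_le_pow_left₀ zero_le h1 2).trans ((lintegral_mul_sq_le (by fun_prop)
      (by fun_prop)).trans ?_)
    rw [eLpNorm_two_sq]
    gcongr
    exact Measure.restrict_le_self
  rw [eLpNorm_two_sq]
  refine (lintegral_mono hpt).trans ?_
  rw [lintegral_const_mul _ (by fun_prop), lintegral_lintegral_swap (by fun_prop)]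
  gcongr
  have h2 : ∀ z : ℝ × ℝ, ∫⁻ x : ℝ × ℝ, ‖h ((1 - ε) • x + ε • z)‖ₑ ^ 2
      = ENNReal.ofReal (((1 - ε) ^ 2)⁻¹) * eLpNorm h 2 volume ^ 2 := by
    intro z
    rw [eLpNorm_two_sq]
    exact lintegral_comp_smul_add (F := fun x => ‖h x‖ₑ ^ 2) (by fun_prop) (by linarith) _
  simp only [h2, lintegral_const, Measure.restrict_apply MeasurableSet.univ, Set.univ_inter]
  rw [mul_comm]

open scoped Convolution in
-- The substitution y = (1 - ε)x + εz. Smoothness and differentiation under the integral sign are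
-- then inherited from convolutions.
theorem dilatedAverage_eq_convolution (ρ f : ℝ × ℝ → ℝ) {ε : ℝ} (hε : 0 < ε) (x : ℝ × ℝ) :
    dilatedAverage ρ ε f x = (f ⋆[ContinuousLinearMap.mul ℝ ℝ, volume]
      fun w => (ε ^ 2)⁻¹ * ρ (-(ε⁻¹ • w))) ((1 - ε) • x) := by
  have h1 : ∀ z : ℝ × ℝ, ρ z * f ((1 - ε) • x + ε • z)
      = (fun y => ρ (ε⁻¹ • y) * f ((1 - ε) • x + y)) (ε • z) := by
    intro z
    simp [smul_smul, hε.ne']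
  rw [dilatedAverage, convolution_def]
  rw [integral_congr_ae (Filter.Eventually.of_forall h1),
    Measure.integral_comp_smul volume (fun y => ρ (ε⁻¹ • y) * f ((1 - ε) • x + y)), ← integral_add_left_eq_self _ (-((1 - ε) • x)), ← integral_smul]
  refine integral_congr_ae (Filter.Eventually.of_forall fun y => ?_)
  have h2 : ε⁻¹ • (-((1 - ε) • x) + y) = -(ε⁻¹ • ((1 - ε) • x - y)) := by
    module
  simp only [Module.finrank_prod, Module.finrank_self, smul_eq_mul, ContinuousLinearMap.mul_apply',
    h2, add_neg_cancel_left]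
  rw [abs_of_nonneg (by positivity)]
  ring

theorem contDiff_kernel {ρ : ℝ × ℝ → ℝ} (hρ : ContDiff ℝ (⊤ : ℕ∞) ρ) (ε : ℝ) :
    ContDiff ℝ (⊤ : ℕ∞) fun w : ℝ × ℝ => (ε ^ 2)⁻¹ * ρ (-(ε⁻¹ • w)) := by
  fun_prop

theorem hasCompactSupport_kernel {ρ : ℝ × ℝ → ℝ} (hρc : HasCompactSupport ρ) {ε : ℝ}
    (hε : 0 < ε) : HasCompactSupport fun w : ℝ × ℝ => (ε ^ 2)⁻¹ * ρ (-(ε⁻¹ • w)) := by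
  have h := hρc.comp_homeomorph ((Homeomorph.smulOfNeZero ε⁻¹ (inv_ne_zero hε.ne')).trans
    (Homeomorph.neg (ℝ × ℝ)))
  exact h.mul_left (f := fun _ => (ε ^ 2)⁻¹)

theorem contDiff_dilatedAverage {ρ f : ℝ × ℝ → ℝ} (hρ : ContDiff ℝ (⊤ : ℕ∞) ρ)
    (hρc : HasCompactSupport ρ) (hf : LocallyIntegrable f volume) {ε : ℝ} (hε : 0 < ε) :
    ContDiff ℝ (⊤ : ℕ∞) (dilatedAverage ρ ε f) := by
  have h : dilatedAverage ρ ε f = _ := funext (dilatedAverage_eq_convolution ρ f hε)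
  rw [h]
  exact ((hasCompactSupport_kernel hρc hε).contDiff_convolution_right _ hf
    (contDiff_kernel hρ ε)).comp (contDiff_const_smul (1 - ε))

open scoped Convolution in
-- For x in U the kernel y ↦ k((1 - ε)x - y) is supported in (1 - ε)x + ε supp ρ, which lies in U by
-- convexity. It is therefore an admissible test function, and no shrinking of the domain is needed.
-- The factor 1 - ε is the chain rule for x ↦ (1 - ε)x.
theorem fderiv_dilatedAverage {U : Set (ℝ × ℝ)} (hUc : Convex ℝ U) {ρ v d : ℝ × ℝ → ℝ}
    {e : ℝ × ℝ} (hρ : ContDiff ℝ (⊤ : ℕ∞) ρ) (hρc : HasCompactSupport ρ) (hρU : tsupport ρ ⊆ U)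
    (hv : LocallyIntegrable v volume) (hvU : Function.support v ⊆ U)
    (hdU : Function.support d ⊆ U) (hd : IsWeakDeriv U e v d) {ε : ℝ} (hε : 0 < ε) (hε1 : ε < 1)
    {x : ℝ × ℝ} (hx : x ∈ U) :
    fderiv ℝ (dilatedAverage ρ ε v) x e = (1 - ε) * dilatedAverage ρ ε d x := by
  set k : ℝ × ℝ → ℝ := fun w => (ε ^ 2)⁻¹ * ρ (-(ε⁻¹ • w)) with hk
  have hks : ContDiff ℝ (⊤ : ℕ∞) k := contDiff_kernel hρ ε
  have hkc : HasCompactSupport k := hasCompactSupport_kernel hρc hε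
  set u : ℝ × ℝ := (1 - ε) • x with hu
  set ψ : ℝ × ℝ → ℝ := fun y => k (u - y) with hψ
  have hψs : ContDiff ℝ (⊤ : ℕ∞) ψ := hks.comp (contDiff_const.sub contDiff_id)
  have hsub : tsupport ψ ⊆ (fun z => u + ε • z) '' tsupport ρ := by
    have hcpt : IsCompact ((fun z : ℝ × ℝ => u + ε • z) '' tsupport ρ) :=
      IsCompact.image hρc (by fun_prop)
    refine closure_minimal (fun y hy => ?_) hcpt.isClosed
    refine ⟨-(ε⁻¹ • (u - y)), subset_tsupport _ ?_, ?_⟩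
    · intro h0
      exact hy (by simp [hψ, hk, h0])
    · simp [smul_smul, hε.ne']
  have hψc : HasCompactSupport ψ :=
    HasCompactSupport.of_support_subset_isCompact (IsCompact.image hρc (by fun_prop))
      ((subset_tsupport ψ).trans hsub)
  have hψU : tsupport ψ ⊆ U := by
    intro y hy
    obtain ⟨z, hz, rfl⟩ := hsub hy
    exact hUc hx (hρU hz) (by linarith) hε.le (by ring)
  have hweak := hd.2 ψ hψs hψc hψU
  have hC := hkc.hasFDerivAt_convolution_right (ContinuousLinearMap.mul ℝ ℝ) (μ := volume) hv
    (hks.of_le (by exact_mod_cast le_top)) u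
  have hD : HasFDerivAt (fun y : ℝ × ℝ => (1 - ε) • y)
      ((1 - ε) • ContinuousLinearMap.id ℝ (ℝ × ℝ)) x := (hasFDerivAt_id x).const_smul (1 - ε)
  have hA : HasFDerivAt (dilatedAverage ρ ε v) _ x :=
    (HasFDerivAt.comp (g := v ⋆[ContinuousLinearMap.mul ℝ ℝ, volume] k) x hC hD).congr_of_eventuallyEq
      (Filter.Eventually.of_forall fun y => dilatedAverage_eq_convolution ρ v hε y)
  rw [hA.fderiv]
  simp only [ContinuousLinearMap.comp_apply, smul_apply,
    ContinuousLinearMap.id_apply, map_smul, smul_eq_mul]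
  congr 1
  rw [convolution_precompR_apply _ hv (hkc.fderiv ℝ)
    (hks.continuous_fderiv (by simp)), dilatedAverage_eq_convolution ρ d hε x, convolution_def,
    convolution_def]
  have hfd : ∀ y, fderiv ℝ ψ y e = -(fderiv ℝ k (u - y) e) := by
    intro y
    have h1 : HasFDerivAt k (fderiv ℝ k (u - y)) (u - y) :=
      (hks.differentiable (by simp) _).hasFDerivAt
    have h2 : HasFDerivAt ψ _ y := h1.comp y ((hasFDerivAt_id y).const_sub u)
    rw [h2.fderiv]
    simp
  have hrestr : ∀ {g w : ℝ × ℝ → ℝ}, Function.support g ⊆ U →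
      ∫ y, g y * w y = ∫ y in U, g y * w y := by
    intro g w hg
    rw [setIntegral_eq_integral_of_forall_compl_eq_zero]
    intro y hy
    rw [Function.notMem_support.1 fun h => hy (hg h), zero_mul]
  simp only [ContinuousLinearMap.mul_apply']
  rw [hrestr hvU, hrestr hdU]
  simp only [hfd, mul_neg, integral_neg, neg_inj] at hweak
  exact hweak

theorem eventually_abs_sub_dilatedAverage_le {U : Set (ℝ × ℝ)} (hUb : Bornology.IsBounded U)
    {ρ g : ℝ × ℝ → ℝ} (hρ : Continuous ρ) (hρc : HasCompactSupport ρ)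
    (hρU : Function.support ρ ⊆ U) (hρ1 : ∫ z, ρ z = 1) (hg : Continuous g)
    (hgc : HasCompactSupport g) {C : ℝ} (hC : 0 < C) :
    ∀ᶠ ε in nhdsWithin (0 : ℝ) (Set.Ioi 0), ∀ x ∈ U, |g x - dilatedAverage ρ ε g x| ≤ C := by
  have hρi : Integrable ρ := hρ.integrable_of_hasCompactSupport hρc
  -- The weight is not assumed nonnegative, so its total mass 1 has to be replaced by the mass of
  -- |ρ| in the estimate.
  set I : ℝ := ∫ z, |ρ z| with hI
  have hI0 : 0 ≤ I := integral_nonneg fun _ => abs_nonneg _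
  have hunif := hgc.uniformContinuous_of_continuous hg
  obtain ⟨r, hr, hgr⟩ := Metric.uniformContinuous_iff.1 hunif (C / (I + 1)) (by positivity)
  obtain ⟨D, hD⟩ := hUb.exists_norm_le
  have hD0 : 0 ≤ max D 0 := le_max_right _ _
  filter_upwards [Ioo_mem_nhdsGT (show (0 : ℝ) < r / (2 * max D 0 + 1) by positivity)]
    with ε hε x hx
  have hclose : ∀ z ∈ U, |g x - g ((1 - ε) • x + ε • z)| ≤ C / (I + 1) := by
    intro z hz
    have h1 : dist x ((1 - ε) • x + ε • z) < r := by
      have h2 : x - ((1 - ε) • x + ε • z) = ε • (x - z) := by module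
      rw [dist_eq_norm, h2, norm_smul, Real.norm_eq_abs, abs_of_pos hε.1]
      have h3 : ‖x - z‖ ≤ 2 * max D 0 := by
        linarith [norm_sub_le x z, hD x hx, hD z hz, le_max_left D 0]
      have h4 := (lt_div_iff₀ (by positivity)).1 hε.2
      nlinarith [hε.1, norm_nonneg (x - z)]
    exact (hgr h1).le
  have hint : Integrable (fun z => ρ z * g ((1 - ε) • x + ε • z)) :=
    Continuous.integrable_of_hasCompactSupport (by fun_prop) hρc.mul_right
  have heq : g x - dilatedAverage ρ ε g x = ∫ z, ρ z * (g x - g ((1 - ε) • x + ε • z)) := by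
    simp only [mul_sub]
    rw [integral_sub (hρi.mul_const _) hint, integral_mul_const, hρ1, one_mul, dilatedAverage]
  rw [heq]
  have h5 : |∫ z, ρ z * (g x - g ((1 - ε) • x + ε • z))| ≤ ∫ z, |ρ z| * (C / (I + 1)) := by
    rw [← Real.norm_eq_abs]
    refine norm_integral_le_of_norm_le (hρi.abs.mul_const _) (Filter.Eventually.of_forall ?_)
    intro z
    rw [Real.norm_eq_abs, abs_mul]
    by_cases hz : z ∈ U
    · exact mul_le_mul_of_nonneg_left (hclose z hz) (abs_nonneg _)
    · have : ρ z = 0 := by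
        by_contra h0
        exact hz (hρU h0)
      simp [this]
  refine h5.trans ?_
  rw [integral_mul_const, ← hI, mul_div_assoc', div_le_iff₀ (by positivity)]
  nlinarith

/-- Convergence is uniform on U for continuous compactly supported functions. These are dense in L²,
and the averaging operators are bounded on L² uniformly for ε < 1/2. -/
theorem tendsto_dilatedAverage {U : Set (ℝ × ℝ)} (hU : MeasurableSet U)
    (hUb : Bornology.IsBounded U) {ρ f : ℝ × ℝ → ℝ} (hρ : ContDiff ℝ (⊤ : ℕ∞) ρ)
    (hρc : HasCompactSupport ρ) (hρU : Function.support ρ ⊆ U) (hρ1 : ∫ z, ρ z = 1)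
    (hf : Measurable f) (hf2 : MemLp f 2 volume) :
    Filter.Tendsto (fun ε => eLpNorm (f - dilatedAverage ρ ε f) 2 (volume.restrict U))
      (nhdsWithin 0 (Set.Ioi 0)) (nhds 0) := by
  -- The 4 bounds (1 - ε)⁻² for ε < 1/2. The summand 1 ensures K ≤ K², so K bounds the operator norm
  -- as well as its square.
  set K : ENNReal := eLpNorm ρ 2 volume ^ 2 * (volume U * 4) + 1 with hK
  have hρ2 : MemLp ρ 2 volume := hρ.continuous.memLp_of_hasCompactSupport hρc
  have hV : volume U < ⊤ := hUb.measure_lt_top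
  have hKtop : K ≠ ⊤ :=
    (ENNReal.add_lt_top.2 ⟨ENNReal.mul_lt_top (ENNReal.pow_lt_top hρ2.2)
      (ENNReal.mul_lt_top hV (by simp)), by simp⟩).ne
  have hbound : ∀ h : ℝ × ℝ → ℝ, Measurable h → ∀ ε : ℝ, ε < 1 / 2 →
      eLpNorm (dilatedAverage ρ ε h) 2 volume ≤ K * eLpNorm h 2 volume := by
    intro h hm ε hε
    have h1 := eLpNorm_dilatedAverage_sq_le hU hρ.continuous.measurable hρU hm
      (hε.trans (by norm_num))
    have h2 : ENNReal.ofReal (((1 - ε) ^ 2)⁻¹) ≤ 4 := by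
      rw [show (4 : ENNReal) = ENNReal.ofReal 4 by simp]
      refine ENNReal.ofReal_le_ofReal (inv_le_of_inv_le₀ (by norm_num) ?_)
      nlinarith
    have h3 : eLpNorm (dilatedAverage ρ ε h) 2 volume ^ 2 ≤ (K * eLpNorm h 2 volume) ^ 2 := by
      calc _ ≤ eLpNorm ρ 2 volume ^ 2 * (volume U * (4 * eLpNorm h 2 volume ^ 2)) := by
            refine h1.trans ?_
            gcongr
        _ = eLpNorm ρ 2 volume ^ 2 * (volume U * 4) * eLpNorm h 2 volume ^ 2 := by ring
        _ ≤ K * eLpNorm h 2 volume ^ 2 := by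
            gcongr
            exact le_self_add
        _ ≤ K ^ 2 * eLpNorm h 2 volume ^ 2 := by
            gcongr
            exact le_self_pow₀ le_add_self two_ne_zero
        _ = _ := by ring
    exact (ENNReal.pow_le_pow_left_iff two_ne_zero).1 h3
  rw [ENNReal.tendsto_nhds_zero]
  intro δ hδ
  rcases eq_or_ne δ ⊤ with rfl | hδt
  · simp
  have hη : δ / 2 / (1 + K) ≠ 0 :=
    (ENNReal.div_pos (ENNReal.half_pos hδ.ne').ne' (by finiteness)).ne'
  obtain ⟨g, hgc, hfg, hg, hg2⟩ := hf2.exists_hasCompactSupport_eLpNorm_sub_le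
    (by simp) hη
  set W : ENNReal := volume U ^ (ENNReal.toReal 2)⁻¹ + 1 with hW
  have hWt : W ≠ ⊤ := by
    refine ENNReal.add_ne_top.2 ⟨?_, by simp⟩
    exact ENNReal.rpow_ne_top_of_nonneg (by positivity) hV.ne
  have hCpos : 0 < (δ / 2 / W).toReal := by
    refine ENNReal.toReal_pos (ENNReal.div_pos (ENNReal.half_pos hδ.ne').ne' hWt).ne' ?_
    exact (ENNReal.div_lt_top (ENNReal.div_lt_top hδt two_ne_zero).ne (by simp [hW])).ne
  filter_upwards [eventually_abs_sub_dilatedAverage_le hUb hρ.continuous hρc hρU hρ1 hg hgc hCpos,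
    Ioo_mem_nhdsGT (show (0 : ℝ) < 1 / 2 by norm_num)] with ε hε hε2
  have hsplit : f - dilatedAverage ρ ε f
      = (f - g) + (g - dilatedAverage ρ ε g) + -dilatedAverage ρ ε (f - g) := by
    funext x
    simp only [Pi.add_apply, Pi.sub_apply, Pi.neg_apply]
    rw [dilatedAverage_sub hρ2 hf hf2 hg.measurable hg2 hε2.1.ne' x]
    ring
  have hmeas : ∀ h : ℝ × ℝ → ℝ, MemLp h 2 volume →
      AEStronglyMeasurable (dilatedAverage ρ ε h) (volume.restrict U) := fun h h2 =>
    (contDiff_dilatedAverage hρ hρc (h2.locallyIntegrable (by norm_num))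
      hε2.1).continuous.aestronglyMeasurable
  have hfgm : AEStronglyMeasurable (f - g) (volume.restrict U) :=
    (hf2.sub hg2).1.restrict
  have h1 : eLpNorm (f - g) 2 (volume.restrict U) ≤ δ / 2 / (1 + K) :=
    (eLpNorm_mono_measure _ Measure.restrict_le_self).trans hfg
  have h2 : eLpNorm (g - dilatedAverage ρ ε g) 2 (volume.restrict U) ≤ δ / 2 := by
    have h3 : ∀ᵐ x ∂volume.restrict U, ‖(g - dilatedAverage ρ ε g) x‖ ≤ (δ / 2 / W).toReal :=
      (ae_restrict_iff' hU).2 (Filter.Eventually.of_forall hε)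
    refine (eLpNorm_le_of_ae_bound h3).trans ?_
    rw [ENNReal.ofReal_toReal (ENNReal.div_lt_top (ENNReal.div_lt_top hδt two_ne_zero).ne
      (by simp [hW])).ne, Measure.restrict_apply MeasurableSet.univ, Set.univ_inter]
    calc _ ≤ W * (δ / 2 / W) := by gcongr; exact le_self_add
      _ ≤ δ / 2 := ENNReal.mul_div_le
  have h4 : eLpNorm (-dilatedAverage ρ ε (f - g)) 2 (volume.restrict U)
      ≤ K * (δ / 2 / (1 + K)) := by
    rw [eLpNorm_neg]
    refine (eLpNorm_mono_measure _ Measure.restrict_le_self).trans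
      ((hbound _ (hf.sub hg.measurable) ε hε2.2).trans ?_)
    gcongr
  rw [hsplit]
  refine (eLpNorm_add_le (hfgm.add (hg.aestronglyMeasurable.sub (hmeas g hg2)))
    (hmeas _ (hf2.sub hg2)).neg (by norm_num)).trans ?_
  calc _ ≤ eLpNorm (f - g) 2 (volume.restrict U)
          + eLpNorm (g - dilatedAverage ρ ε g) 2 (volume.restrict U)
          + eLpNorm (-dilatedAverage ρ ε (f - g)) 2 (volume.restrict U) := by
        gcongr
        exact eLpNorm_add_le hfgm (hg.aestronglyMeasurable.sub (hmeas g hg2)) (by norm_num)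
    _ ≤ δ / 2 / (1 + K) + δ / 2 + K * (δ / 2 / (1 + K)) := by gcongr
    _ = (1 + K) * (δ / 2 / (1 + K)) + δ / 2 := by ring
    _ ≤ δ / 2 + δ / 2 := by gcongr; exact ENNReal.mul_div_le
    _ = δ := ENNReal.add_halves δ

theorem exists_contDiff_weight {U : Set (ℝ × ℝ)} (hU : IsOpen U) (hne : U.Nonempty) :
    ∃ ρ : ℝ × ℝ → ℝ, ContDiff ℝ (⊤ : ℕ∞) ρ ∧ HasCompactSupport ρ ∧ tsupport ρ ⊆ U ∧
      ∫ z, ρ z = 1 := by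
  obtain ⟨c, hc⟩ := hne
  obtain ⟨r, hr, hball⟩ := Metric.isOpen_iff.1 hU c hc
  let b : ContDiffBump c := ⟨r / 4, r / 2, by positivity, by linarith⟩
  refine ⟨b.normed volume, b.contDiff_normed, b.hasCompactSupport_normed, ?_, b.integral_normed⟩
  rw [b.tsupport_normed_eq]
  exact (Metric.closedBall_subset_ball (by simp [b]; linarith)).trans hball

theorem IsWeakDeriv.congr {U : Set (ℝ × ℝ)} {e : ℝ × ℝ} {v v' d d' : ℝ × ℝ → ℝ}
    (h : IsWeakDeriv U e v d) (hv : v =ᵐ[volume.restrict U] v')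
    (hd : d =ᵐ[volume.restrict U] d') : IsWeakDeriv U e v' d' := by
  refine ⟨(memLp_congr_ae hd).1 h.1, fun φ h1 h2 h3 => ?_⟩
  have h4 := h.2 φ h1 h2 h3
  have e1 : ∫ x in U, v x * fderiv ℝ φ x e = ∫ x in U, v' x * fderiv ℝ φ x e :=
    integral_congr_ae (hv.mono fun x hx => by simp [hx])
  have e2 : ∫ x in U, d x * φ x = ∫ x in U, d' x * φ x :=
    integral_congr_ae (hd.mono fun x hx => by simp [hx])
  rw [← e1, ← e2, h4]

/-- Extension by zero to a measurable function on the plane, which the averages and convolutions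
need. -/
theorem exists_measurable_representative {U : Set (ℝ × ℝ)} (hU : MeasurableSet U)
    {v : ℝ × ℝ → ℝ} (hv : MemLp v 2 (volume.restrict U)) :
    ∃ v', Measurable v' ∧ MemLp v' 2 volume ∧ Function.support v' ⊆ U ∧
      v =ᵐ[volume.restrict U] v' := by
  have h1 : v =ᵐ[volume.restrict U] U.indicator (hv.1.mk v) :=
    hv.1.ae_eq_mk.trans (indicator_ae_eq_restrict hU).symm
  refine ⟨U.indicator (hv.1.mk v), hv.1.stronglyMeasurable_mk.measurable.indicator hU, ?_,
    Set.support_indicator_subset, h1⟩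
  rw [memLp_indicator_iff_restrict hU]
  exact (memLp_congr_ae hv.1.ae_eq_mk).1 hv

theorem l2Norm_congr {U : Set (ℝ × ℝ)} {f g : ℝ × ℝ → ℝ} (h : f =ᵐ[volume.restrict U] g) :
    l2Norm U f = l2Norm U g := by
  unfold l2Norm
  congr 1
  exact integral_congr_ae (h.mono fun x hx => by simp [hx])

theorem memLp_of_continuous_of_isBounded {U : Set (ℝ × ℝ)} (hU : Bornology.IsBounded U)
    {f : ℝ × ℝ → ℝ} (hf : Continuous f) : MemLp f 2 (volume.restrict U) := by
  have h : MemLp f 2 (volume.restrict (closure U)) := by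
    have : IsFiniteMeasure (volume.restrict (closure U)) :=
      ⟨by simpa using hU.isCompact_closure.measure_lt_top⟩
    obtain ⟨C, hC⟩ := hU.isCompact_closure.exists_bound_of_continuousOn hf.continuousOn
    exact MemLp.of_bound hf.aestronglyMeasurable C
      ((ae_restrict_iff' isClosed_closure.measurableSet).2 (Filter.Eventually.of_forall hC))
  exact h.mono_measure (Measure.restrict_mono subset_closure le_rfl)

/-- Dilated averages with ε → 0 approximate v. Their derivatives are, up to the factor 1 - ε,
dilated averages of the weak derivative, so one sequence serves every direction at once. -/
theorem exists_contDiff_tendsto {U : Set (ℝ × ℝ)} (hU : IsOpen U) (hUc : Convex ℝ U)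
    (hUb : Bornology.IsBounded U) (hne : U.Nonempty) {v : ℝ × ℝ → ℝ}
    (hv : MemLp v 2 (volume.restrict U)) :
    ∃ φ : ℕ → ℝ × ℝ → ℝ, (∀ n, ContDiff ℝ (⊤ : ℕ∞) (φ n)) ∧
      Filter.Tendsto (fun n => l2Norm U (fun x => v x - φ n x)) Filter.atTop (nhds 0) ∧
      ∀ e d, IsWeakDeriv U e v d →
        Filter.Tendsto (fun n => l2Norm U (fun x => d x - fderiv ℝ (φ n) x e))
          Filter.atTop (nhds 0) := by
  obtain ⟨ρ, hρ, hρc, hρU, hρ1⟩ := exists_contDiff_weight hU hne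
  have hρU' := (subset_tsupport ρ).trans hρU
  obtain ⟨v', hv'm, hv'2, hv'U, hvv'⟩ := exists_measurable_representative hU.measurableSet hv
  let s : ℕ → ℝ := fun n => 1 / ((n : ℝ) + 2)
  have hs0 : ∀ n, 0 < s n := fun n => by positivity
  have hs1 : ∀ n, s n < 1 := fun n => by
    rw [div_lt_one (by positivity)]
    linarith [n.cast_nonneg (α := ℝ)]
  have hs : Filter.Tendsto s Filter.atTop (nhdsWithin 0 (Set.Ioi 0)) := by
    refine tendsto_nhdsWithin_iff.2 ⟨?_, Filter.Eventually.of_forall hs0⟩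
    have := tendsto_one_div_add_atTop_nhds_zero_nat (𝕜 := ℝ)
    refine (this.comp (Filter.tendsto_add_atTop_nat 1)).congr fun n => ?_
    simp only [s, Function.comp_apply]
    push_cast
    ring
  have hsm : ∀ {f : ℝ × ℝ → ℝ}, MemLp f 2 volume → ∀ n,
      ContDiff ℝ (⊤ : ℕ∞) (dilatedAverage ρ (s n) f) := fun hf n =>
    contDiff_dilatedAverage hρ hρc (hf.locallyIntegrable (by norm_num)) (hs0 n)
  have hlim : ∀ {f : ℝ × ℝ → ℝ}, Measurable f → MemLp f 2 volume →
      Filter.Tendsto (fun n => l2Norm U (fun x => f x - dilatedAverage ρ (s n) f x))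
        Filter.atTop (nhds 0) := by
    intro f hf hf2
    have h1 := (tendsto_dilatedAverage hU.measurableSet hUb hρ hρc hρU' hρ1 hf hf2).comp hs
    have h2 := (ENNReal.tendsto_toReal ENNReal.zero_ne_top).comp h1
    refine h2.congr fun n => ?_
    exact (sqrt_integral_sq_eq_toReal_eLpNorm ((hf2.restrict U).sub
      (memLp_of_continuous_of_isBounded hUb (hsm hf2 n).continuous))).symm
  refine ⟨fun n => dilatedAverage ρ (s n) v', hsm hv'2, ?_, fun e d hd => ?_⟩
  · refine (hlim hv'm hv'2).congr fun n => l2Norm_congr ?_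
    filter_upwards [hvv'] with x hx
    rw [hx]
  · obtain ⟨d', hd'm, hd'2, hd'U, hdd'⟩ := exists_measurable_representative hU.measurableSet hd.1
    have hw := hd.congr hvv' hdd'
    have hd2 : MemLp d' 2 (volume.restrict U) := hd'2.restrict U
    have hav : ∀ n, MemLp (dilatedAverage ρ (s n) d') 2 (volume.restrict U) := fun n =>
      memLp_of_continuous_of_isBounded hUb (hsm hd'2 n).continuous
    have hs' : Filter.Tendsto s Filter.atTop (nhds 0) := hs.mono_right nhdsWithin_le_nhds
    -- With A the averaging operator, d - (1 - s)Ad = (1 - s)(d - Ad) + s d.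
    have hB : Filter.Tendsto (fun n => (1 - s n)
        * l2Norm U (fun x => d' x - dilatedAverage ρ (s n) d' x) + s n * l2Norm U d')
        Filter.atTop (nhds 0) := by
      simpa using ((hs'.const_sub 1).mul (hlim hd'm hd'2)).add (hs'.mul_const (l2Norm U d'))
    refine squeeze_zero (fun n => Real.sqrt_nonneg _) (fun n => ?_) hB
    have hscale : ∀ (c : ℝ) (_ : 0 ≤ c) (f : ℝ × ℝ → ℝ),
        l2Norm U (fun x => c * f x) = c * l2Norm U f := by
      intro c hc f
      simp only [l2Norm, mul_pow, integral_const_mul]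
      rw [Real.sqrt_mul (sq_nonneg c), Real.sqrt_sq hc]
    rw [← hscale _ (by linarith [hs1 n]), ← hscale _ (hs0 n).le]
    refine le_trans (le_of_eq (l2Norm_congr ?_)) (sqrt_integral_sq_add_le
      ((hd2.sub (hav n)).const_mul (1 - s n)) (hd2.const_mul (s n)))
    filter_upwards [hdd', ae_restrict_mem hU.measurableSet] with x hx hxU
    rw [fderiv_dilatedAverage hUc hρ hρc hρU (hv'2.locallyIntegrable (by norm_num)) hv'U hd'U hw
      (hs0 n) (hs1 n) hxU, hx]
    ring

end Density

/-! ### Weak derivatives -/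

section WeakDeriv

variable {U : Set (ℝ × ℝ)} {e : ℝ × ℝ} {v w d d' : ℝ × ℝ → ℝ}

theorem memLp_restrict_of_hasCompactSupport {φ : ℝ × ℝ → ℝ} (h : Continuous φ)
    (hc : HasCompactSupport φ) : MemLp φ 2 (volume.restrict U) :=
  (h.memLp_of_hasCompactSupport hc).restrict U

theorem memLp_fderiv_of_hasCompactSupport {φ : ℝ × ℝ → ℝ} (h : ContDiff ℝ (⊤ : ℕ∞) φ)
    (hc : HasCompactSupport φ) (e : ℝ × ℝ) :
    MemLp (fun x => fderiv ℝ φ x e) 2 (volume.restrict U) :=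
  memLp_restrict_of_hasCompactSupport
    ((h.continuous_fderiv (by simp)).clm_apply continuous_const) (hc.fderiv_apply ℝ e)

/-- The fundamental lemma of the calculus of variations. It lets the chosen `weakDeriv` be replaced
almost everywhere by any explicit weak derivative. -/
theorem IsWeakDeriv.ae_eq (hU : IsOpen U) (h : IsWeakDeriv U e v d) (h' : IsWeakDeriv U e v d') :
    d =ᵐ[volume.restrict U] d' := by
  have hsub : MemLp (d - d') 2 (volume.restrict U) := h.1.sub h'.1
  have hloc : LocallyIntegrableOn (d - d') U volume :=
    locallyIntegrableOn_of_locallyIntegrable_restrict (hsub.locallyIntegrable (by norm_num))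
  have h0 := hU.ae_eq_zero_of_integral_contDiff_smul_eq_zero hloc (fun g hg hgc hgU => by
    have hg2 : MemLp g 2 (volume.restrict U) :=
      memLp_restrict_of_hasCompactSupport hg.continuous hgc
    have h1 := h.2 g hg hgc hgU
    have h2 := h'.2 g hg hgc hgU
    have h3 : ∫ x, g x • (d - d') x = ∫ x in U, (d x * g x - d' x * g x) := by
      rw [← setIntegral_eq_integral_of_forall_compl_eq_zero (s := U)]
      · refine integral_congr_ae (Filter.Eventually.of_forall fun x => ?_)
        simp only [Pi.sub_apply, smul_eq_mul]
        ring
      · intro x hx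
        rw [image_eq_zero_of_notMem_tsupport fun h => hx (hgU h), zero_smul]
    rw [h3, integral_sub (f := fun x => d x * g x) (g := fun x => d' x * g x)
      (h.1.integrable_mul hg2) (h'.1.integrable_mul hg2)]
    linarith)
  refine (ae_restrict_iff' hU.measurableSet).2 ?_
  filter_upwards [h0] with x hx hxU
  exact sub_eq_zero.1 (hx hxU)

theorem IsWeakDeriv.linear (hv : MemLp v 2 (volume.restrict U)) (hw : MemLp w 2 (volume.restrict U))
    (h : IsWeakDeriv U e v d) (h' : IsWeakDeriv U e w d') (a b : ℝ) :
    IsWeakDeriv U e (fun x => a * v x + b * w x) (fun x => a * d x + b * d' x) := by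
  refine ⟨(h.1.const_mul a).add (h'.1.const_mul b), fun φ hφ hc hs => ?_⟩
  have hφ2 : MemLp φ 2 (volume.restrict U) :=
    memLp_restrict_of_hasCompactSupport hφ.continuous hc
  have hφ' := memLp_fderiv_of_hasCompactSupport (U := U) hφ hc e
  have key : ∀ {f g k : ℝ × ℝ → ℝ}, MemLp f 2 (volume.restrict U) →
      MemLp g 2 (volume.restrict U) → MemLp k 2 (volume.restrict U) →
      ∫ x in U, (a * f x + b * g x) * k x
        = a * (∫ x in U, f x * k x) + b * ∫ x in U, g x * k x := by
    intro f g k hf hg hk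
    rw [← integral_const_mul, ← integral_const_mul, ← integral_add
      (f := fun x => a * (f x * k x)) (g := fun x => b * (g x * k x))
      ((hf.integrable_mul hk).const_mul a) ((hg.integrable_mul hk).const_mul b)]
    exact integral_congr_ae (Filter.Eventually.of_forall fun x => by ring)
  rw [key hv hw hφ', key h.1 h'.1 hφ2, h.2 φ hφ hc hs, h'.2 φ hφ hc hs]
  ring

theorem isWeakDeriv_of_contDiff (hU : Bornology.IsBounded U) {f : ℝ × ℝ → ℝ}
    (hf : ContDiff ℝ (⊤ : ℕ∞) f) (e : ℝ × ℝ) :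
    IsWeakDeriv U e f (fun x => fderiv ℝ f x e) := by
  have hf' : Continuous fun x => fderiv ℝ f x e :=
    (hf.continuous_fderiv (by simp)).clm_apply continuous_const
  refine ⟨memLp_of_continuous_of_isBounded hU hf', fun φ hφ hc hs => ?_⟩
  have hφ' : Continuous fun x => fderiv ℝ φ x e :=
    (hφ.continuous_fderiv (by simp)).clm_apply continuous_const
  have h0 : ∀ x ∉ U, φ x = 0 := fun x hx =>
    image_eq_zero_of_notMem_tsupport fun h => hx (hs h)
  have h1 : ∀ x ∉ U, fderiv ℝ φ x = 0 := fun x hx =>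
    image_eq_zero_of_notMem_tsupport fun h => hx (hs (tsupport_fderiv_subset ℝ h))
  rw [setIntegral_eq_integral_of_forall_compl_eq_zero fun x hx => by rw [h1 x hx]; simp,
    setIntegral_eq_integral_of_forall_compl_eq_zero fun x hx => by rw [h0 x hx]; simp]
  refine integral_mul_fderiv_eq_neg_fderiv_mul_of_integrable ?_ ?_ ?_
    (fun x _ => hf.differentiable (by simp) x) (fun x _ => hφ.differentiable (by simp) x)
  · exact (hf'.mul hφ.continuous).integrable_of_hasCompactSupport hc.mul_left
  · exact (hf.continuous.mul hφ').integrable_of_hasCompactSupport (hc.fderiv_apply ℝ e).mul_left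
  · exact (hf.continuous.mul hφ.continuous).integrable_of_hasCompactSupport hc.mul_left

theorem memH1_of_contDiff (hU : Bornology.IsBounded U) {f : ℝ × ℝ → ℝ}
    (hf : ContDiff ℝ (⊤ : ℕ∞) f) : MemH1 U f :=
  ⟨memLp_of_continuous_of_isBounded hU hf.continuous, ⟨_, isWeakDeriv_of_contDiff hU hf _⟩,
    ⟨_, isWeakDeriv_of_contDiff hU hf _⟩⟩

theorem MemH1.linear (hv : MemH1 U v) (hw : MemH1 U w) (a b : ℝ) :
    MemH1 U (fun x => a * v x + b * w x) := by
  obtain ⟨hv2, ⟨d₁, h₁⟩, ⟨d₂, h₂⟩⟩ := hv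
  obtain ⟨hw2, ⟨k₁, l₁⟩, ⟨k₂, l₂⟩⟩ := hw
  exact ⟨(hv2.const_mul a).add (hw2.const_mul b), ⟨_, h₁.linear hv2 hw2 l₁ a b⟩,
    ⟨_, h₂.linear hv2 hw2 l₂ a b⟩⟩

theorem isWeakDeriv_weakDeriv (h : ∃ d, IsWeakDeriv U e v d) :
    IsWeakDeriv U e v (weakDeriv U e v) := by
  rw [weakDeriv, dif_pos h]
  exact h.choose_spec

theorem MemH1.isWeakDeriv (hv : MemH1 U v) (he : e ∈ ({(1, 0), (0, 1)} : Set (ℝ × ℝ))) :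
    IsWeakDeriv U e v (weakDeriv U e v) := by
  rcases he with rfl | rfl
  · exact isWeakDeriv_weakDeriv hv.2.1
  · exact isWeakDeriv_weakDeriv hv.2.2

theorem IsWeakDeriv.weakDeriv_ae_eq (hU : IsOpen U) (h : IsWeakDeriv U e v d) :
    weakDeriv U e v =ᵐ[volume.restrict U] d :=
  (isWeakDeriv_weakDeriv ⟨d, h⟩).ae_eq hU h

theorem MemH1.weakDeriv_linear (hU : IsOpen U) (hv : MemH1 U v) (hw : MemH1 U w)
    (he : e ∈ ({(1, 0), (0, 1)} : Set (ℝ × ℝ))) (a b : ℝ) :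
    weakDeriv U e (fun x => a * v x + b * w x)
      =ᵐ[volume.restrict U] fun x => a * weakDeriv U e v x + b * weakDeriv U e w x :=
  ((hv.isWeakDeriv he).linear hv.1 hw.1 (hw.isWeakDeriv he) a b).weakDeriv_ae_eq hU

end WeakDeriv

/-! ### Triangles -/

section Triangle

/-- Twice the signed area of the triangle `PQR`. -/
def signedArea (P Q R : ℝ × ℝ) : ℝ :=
  (Q.1 - P.1) * (R.2 - P.2) - (Q.2 - P.2) * (R.1 - P.1)

theorem openTriangle_rotate (P Q R : ℝ × ℝ) : openTriangle P Q R = openTriangle Q R P := by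
  ext x
  constructor
  · rintro ⟨a, b, c, ha, hb, hc, h, rfl⟩
    exact ⟨b, c, a, hb, hc, ha, by linarith, by module⟩
  · rintro ⟨a, b, c, ha, hb, hc, h, rfl⟩
    exact ⟨c, a, b, hc, ha, hb, by linarith, by module⟩

/-- Barycentric coordinates are quotients of signed areas. -/
theorem mem_openTriangle_iff {P Q R : ℝ × ℝ} (hD : 0 < signedArea P Q R) {x : ℝ × ℝ} :
    x ∈ openTriangle P Q R ↔
      0 < signedArea x Q R ∧ 0 < signedArea P x R ∧ 0 < signedArea P Q x := by
  constructor
  · rintro ⟨a, b, c, ha, hb, hc, h, rfl⟩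
    obtain rfl : a = 1 - b - c := by linarith
    have e1 : signedArea ((1 - b - c) • P + b • Q + c • R) Q R
        = (1 - b - c) * signedArea P Q R := by
      simp only [signedArea, Prod.fst_add, Prod.snd_add, Prod.smul_fst, Prod.smul_snd, smul_eq_mul]
      ring
    have e2 : signedArea P ((1 - b - c) • P + b • Q + c • R) R = b * signedArea P Q R := by
      simp only [signedArea, Prod.fst_add, Prod.snd_add, Prod.smul_fst, Prod.smul_snd, smul_eq_mul]
      ring
    have e3 : signedArea P Q ((1 - b - c) • P + b • Q + c • R) = c * signedArea P Q R := by
      simp only [signedArea, Prod.fst_add, Prod.snd_add, Prod.smul_fst, Prod.smul_snd, smul_eq_mul]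
      ring
    rw [e1, e2, e3]
    exact ⟨mul_pos ha hD, mul_pos hb hD, mul_pos hc hD⟩
  · rintro ⟨h1, h2, h3⟩
    refine ⟨_, _, _, div_pos h1 hD, div_pos h2 hD, div_pos h3 hD, ?_, ?_⟩
    · rw [← add_div, ← add_div, div_eq_one_iff_eq hD.ne']
      simp only [signedArea]
      ring
    · have hD' := hD.ne'
      ext
      · simp only [Prod.fst_add, Prod.smul_fst, smul_eq_mul]
        field_simp
        simp only [signedArea]
        ring
      · simp only [Prod.snd_add, Prod.smul_snd, smul_eq_mul]
        field_simp
        simp only [signedArea]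
        ring

theorem isOpen_openTriangle {P Q R : ℝ × ℝ} (hD : 0 < signedArea P Q R) :
    IsOpen (openTriangle P Q R) := by
  have h : openTriangle P Q R = {x | 0 < signedArea x Q R} ∩
      ({x | 0 < signedArea P x R} ∩ {x | 0 < signedArea P Q x}) :=
    Set.ext fun x => mem_openTriangle_iff hD
  rw [h]
  unfold signedArea
  exact (isOpen_lt (by fun_prop) (by fun_prop)).inter
    ((isOpen_lt (by fun_prop) (by fun_prop)).inter (isOpen_lt (by fun_prop) (by fun_prop)))

theorem convex_openTriangle (P Q R : ℝ × ℝ) : Convex ℝ (openTriangle P Q R) := by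
  rintro _ ⟨a, b, c, ha, hb, hc, h, rfl⟩ _ ⟨a', b', c', ha', hb', hc', h', rfl⟩ s t hs ht hst
  have key : ∀ {p q : ℝ}, 0 < p → 0 < q → 0 < s * p + t * q := by
    intro p q hp hq
    rcases hs.eq_or_lt with rfl | hs'
    · simp only [zero_add] at hst
      simpa [hst] using hq
    · have := mul_pos hs' hp
      have := mul_nonneg ht hq.le
      linarith
  refine ⟨s * a + t * a', s * b + t * b', s * c + t * c', key ha ha', key hb hb', key hc hc', ?_,
    by module⟩
  linear_combination s * h + t * h' + hst

theorem isBounded_openTriangle (P Q R : ℝ × ℝ) : Bornology.IsBounded (openTriangle P Q R) := by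
  refine isBounded_iff_forall_norm_le.2 ⟨‖P‖ + ‖Q‖ + ‖R‖, ?_⟩
  rintro _ ⟨a, b, c, ha, hb, hc, h, rfl⟩
  have key : ∀ {t : ℝ} (X : ℝ × ℝ), 0 < t → t ≤ 1 → ‖t • X‖ ≤ ‖X‖ := by
    intro t X h0 h1
    rw [norm_smul, Real.norm_eq_abs, abs_of_pos h0]
    exact mul_le_of_le_one_left (norm_nonneg X) h1
  exact norm_add₃_le.trans (add_le_add_three (key P ha (by linarith)) (key Q hb (by linarith))
    (key R hc (by linarith)))

theorem nonempty_openTriangle (P Q R : ℝ × ℝ) : (openTriangle P Q R).Nonempty :=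
  ⟨_, 1 / 3, 1 / 3, 1 / 3, by norm_num, by norm_num, by norm_num, by norm_num, rfl⟩

/-! ### Integration over a triangle along rays from a vertex. -/

/-- Coordinates of the triangle `PSE` on the unit square that blow up the vertex `P`. -/
def coneMap (P S E : ℝ × ℝ) (y : ℝ × ℝ) : ℝ × ℝ := P + y.1 • (S + y.2 • (E - S) - P)

theorem image_coneMap (P S E : ℝ × ℝ) :
    coneMap P S E '' (Set.Ioo 0 1 ×ˢ Set.Ioo 0 1) = openTriangle P S E := by
  ext x
  constructor
  · rintro ⟨⟨r, t⟩, ⟨hr, ht⟩, rfl⟩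
    simp only [Set.mem_Ioo] at hr ht
    refine ⟨1 - r, r * (1 - t), r * t, by linarith, mul_pos hr.1 (by linarith),
      mul_pos hr.1 ht.1, by ring, ?_⟩
    simp only [coneMap]
    module
  · rintro ⟨a, b, c, ha, hb, hc, h, rfl⟩
    -- The first coordinate is one minus the weight of P; the second locates the point where the ray
    -- from P meets the opposite edge.
    refine ⟨(b + c, c / (b + c)), ⟨⟨by simp only; linarith, by simp only; linarith⟩,
      ⟨by simp only; positivity, ?_⟩⟩, ?_⟩
    · simp only
      rw [div_lt_one (by linarith)]
      linarith
    · obtain rfl : a = 1 - b - c := by linarith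
      have hbc : b + c ≠ 0 := by positivity
      simp only [coneMap]
      ext
      · simp only [Prod.fst_add, Prod.fst_sub, Prod.smul_fst, smul_eq_mul]
        field_simp
        ring
      · simp only [Prod.snd_add, Prod.snd_sub, Prod.smul_snd, smul_eq_mul]
        field_simp
        ring

theorem injOn_coneMap {P S E : ℝ × ℝ} (hD : 0 < signedArea P S E) :
    Set.InjOn (coneMap P S E) (Set.Ioo 0 1 ×ˢ Set.Ioo 0 1) := by
  rintro ⟨r, t⟩ ⟨hr, ht⟩ ⟨r', t'⟩ ⟨hr', ht'⟩ h
  simp only [Set.mem_Ioo] at hr ht hr' ht'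
  -- The barycentric weights r(1 - t) of S and rt of E are read off as areas; their sum gives r, and
  -- then t follows.
  have e1 : ∀ r t : ℝ, signedArea P (coneMap P S E (r, t)) E = r * (1 - t) * signedArea P S E := by
    intro r t
    simp only [signedArea, coneMap, Prod.fst_add, Prod.snd_add, Prod.smul_fst, Prod.smul_snd,
      Prod.fst_sub, Prod.snd_sub, smul_eq_mul]
    ring
  have e2 : ∀ r t : ℝ, signedArea P S (coneMap P S E (r, t)) = r * t * signedArea P S E := by
    intro r t
    simp only [signedArea, coneMap, Prod.fst_add, Prod.snd_add, Prod.smul_fst, Prod.smul_snd,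
      Prod.fst_sub, Prod.snd_sub, smul_eq_mul]
    ring
  have h1 : r * (1 - t) = r' * (1 - t') :=
    mul_right_cancel₀ hD.ne' (by rw [← e1, ← e1, h])
  have h2 : r * t = r' * t' := mul_right_cancel₀ hD.ne' (by rw [← e2, ← e2, h])
  have h3 : r = r' := by linarith
  subst h3
  rw [mul_left_cancel₀ hr.1.ne' h2]

/-- The derivative of `coneMap`. -/
noncomputable def coneMapDeriv (P S E y : ℝ × ℝ) : (ℝ × ℝ) →L[ℝ] ℝ × ℝ :=
  LinearMap.toContinuousLinearMap (Matrix.toLin (Module.Basis.finTwoProd ℝ)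
    (Module.Basis.finTwoProd ℝ)
    !![S.1 + y.2 * (E.1 - S.1) - P.1, y.1 * (E.1 - S.1);
      S.2 + y.2 * (E.2 - S.2) - P.2, y.1 * (E.2 - S.2)])

theorem det_coneMapDeriv (P S E y : ℝ × ℝ) :
    (coneMapDeriv P S E y).det = y.1 * signedArea P S E := by
  simp only [coneMapDeriv, ContinuousLinearMap.det, LinearMap.coe_toContinuousLinearMap,
    LinearMap.det_toLin, Matrix.det_fin_two_of, signedArea]
  ring

theorem hasFDerivAt_coneMap (P S E y : ℝ × ℝ) :
    HasFDerivAt (coneMap P S E) (coneMapDeriv P S E y) y := by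
  have h₂ : HasFDerivAt (fun y : ℝ × ℝ => y.2) (ContinuousLinearMap.snd ℝ ℝ ℝ) y := hasFDerivAt_snd
  have hx : HasFDerivAt (fun y : ℝ × ℝ => P.1 + y.1 * (S.1 + y.2 * (E.1 - S.1) - P.1)) _ y :=
    (hasFDerivAt_fst.mul (((h₂.mul_const (E.1 - S.1)).const_add S.1).sub_const
      P.1)).const_add P.1
  have hy : HasFDerivAt (fun y : ℝ × ℝ => P.2 + y.1 * (S.2 + y.2 * (E.2 - S.2) - P.2)) _ y :=
    (hasFDerivAt_fst.mul (((h₂.mul_const (E.2 - S.2)).const_add S.2).sub_const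
      P.2)).const_add P.2
  have h : HasFDerivAt (coneMap P S E) _ y := hx.prodMk hy
  refine h.congr_fderiv ?_
  ext <;> simp [coneMapDeriv, Matrix.toLin_finTwoProd_apply]

theorem integral_openTriangle {P S E : ℝ × ℝ} (hD : 0 < signedArea P S E) {f : ℝ × ℝ → ℝ}
    (hf : Continuous f) :
    ∫ x in openTriangle P S E, f x = signedArea P S E *
      ∫ t in (0 : ℝ)..1, ∫ r in (0 : ℝ)..1, r * f (P + r • (S + t • (E - S) - P)) := by
  rw [← image_coneMap, integral_image_eq_integral_abs_det_fderiv_smul volume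
    (measurableSet_Ioo.prod measurableSet_Ioo)
    (fun y _ => (hasFDerivAt_coneMap P S E y).hasFDerivWithinAt) (injOn_coneMap hD)]
  have hc : Continuous fun y : ℝ × ℝ => |(coneMapDeriv P S E y).det| • f (coneMap P S E y) := by
    simp only [det_coneMapDeriv, coneMap]
    fun_prop
  have hint : IntegrableOn (fun y : ℝ × ℝ => |(coneMapDeriv P S E y).det| • f (coneMap P S E y))
      (Set.Ioo 0 1 ×ˢ Set.Ioo 0 1) (volume.prod volume) :=
    (hc.integrableOn_Icc (a := ((0 : ℝ), (0 : ℝ))) (b := (1, 1))).mono_set (by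
      rw [← Set.Icc_prod_Icc]
      exact Set.prod_mono Set.Ioo_subset_Icc_self Set.Ioo_subset_Icc_self)
  rw [IntegrableOn, ← Measure.prod_restrict] at hint
  rw [Measure.volume_eq_prod, ← Measure.prod_restrict, integral_prod_symm _ hint]
  rw [intervalIntegral.integral_of_le zero_le_one, ← integral_Ioc_eq_integral_Ioo,
    ← integral_const_mul]
  refine integral_congr_ae (Filter.Eventually.of_forall fun t => ?_)
  simp only
  rw [intervalIntegral.integral_of_le zero_le_one, ← integral_const_mul,
    integral_Ioc_eq_integral_Ioo]
  refine setIntegral_congr_fun measurableSet_Ioo fun r hr => ?_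
  simp only [det_coneMapDeriv, coneMap, smul_eq_mul]
  rw [abs_of_pos (mul_pos hr.1 hD)]
  ring

/-- The divergence theorem for the field `φ (x - P)`, which has no flux through the two edges
that meet in `P`. -/
theorem integral_openTriangle_fderiv {P S E : ℝ × ℝ} (hD : 0 < signedArea P S E) {φ : ℝ × ℝ → ℝ}
    (hφ : ContDiff ℝ (⊤ : ℕ∞) φ) :
    ∫ x in openTriangle P S E, (fderiv ℝ φ x (x - P) + 2 * φ x)
      = signedArea P S E * ∫ t in (0 : ℝ)..1, φ (S + t • (E - S)) := by
  have hφ' := hφ.continuous_fderiv (n := (⊤ : ℕ∞)) (by simp)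
  rw [integral_openTriangle hD (f := fun x => fderiv ℝ φ x (x - P) + 2 * φ x)
    ((hφ'.clm_apply (by fun_prop)).add (hφ.continuous.const_mul 2))]
  congr 1
  refine intervalIntegral.integral_congr fun t _ => ?_
  set z := S + t • (E - S) with hz
  -- With the Jacobian factor r the integrand along a ray is the exact derivative of r² φ, which
  -- vanishes at P and equals φ on the opposite edge.
  have hder : ∀ r : ℝ, HasDerivAt (fun r : ℝ => r ^ 2 * φ (P + r • (z - P)))
      (r * (fderiv ℝ φ (P + r • (z - P)) (P + r • (z - P) - P) + 2 * φ (P + r • (z - P)))) r := by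
    intro r
    have h1 : HasDerivAt (fun r : ℝ => P + r • (z - P)) (z - P) r := by
      simpa using ((hasDerivAt_id r).smul_const (z - P)).const_add P
    have h2 := (hφ.differentiable (by simp) (P + r • (z - P))).hasFDerivAt.comp_hasDerivAt r h1
    have h3 := (hasDerivAt_pow 2 r).mul h2
    refine h3.congr_deriv ?_
    simp only [add_sub_cancel_left, map_smul, smul_eq_mul, Function.comp_apply, Nat.cast_ofNat]
    ring
  rw [intervalIntegral.integral_eq_sub_of_hasDerivAt (fun r _ => hder r)]
  · simp
  · refine Continuous.intervalIntegrable ?_ _ _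
    have hp : Continuous fun r : ℝ => P + r • (z - P) := by fun_prop
    exact continuous_id.mul (((hφ'.comp hp).clm_apply (hp.sub continuous_const)).add
      ((hφ.continuous.comp hp).const_mul 2))

end Triangle

/-! ### Traces and edge integrals -/

section Edge

variable {α θ : ℝ}

/-- The vertex opposite to the `i`-th edge. -/
noncomputable def edgeApex (α θ : ℝ) : Fin 3 → ℝ × ℝ := ![vertexB α θ, vertexA, 0]

theorem openTriangle_edge (α θ : ℝ) (i : Fin 3) :
    openTriangle (edgeApex α θ i) (edgeStart α θ i) (edgeEnd α θ i) = triangleT α θ := by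
  fin_cases i
  · simp only [edgeApex, edgeStart, edgeEnd, triangleT]
    exact openTriangle_rotate _ _ _
  · simp only [edgeApex, edgeStart, edgeEnd, triangleT]
    exact (openTriangle_rotate _ _ _).symm
  · rfl

theorem signedArea_edge (α θ : ℝ) (i : Fin 3) :
    signedArea (edgeApex α θ i) (edgeStart α θ i) (edgeEnd α θ i) = α * Real.sin θ := by
  fin_cases i <;>
    simp only [edgeApex, edgeStart, edgeEnd, signedArea, vertexA, vertexB, Fin.zero_eta,
      Fin.mk_one, Fin.reduceFinMk, Matrix.cons_val, Prod.fst_zero, Prod.snd_zero] <;>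
    ring

theorem signedArea_triangleT (α θ : ℝ) :
    signedArea 0 vertexA (vertexB α θ) = α * Real.sin θ := by
  simp [signedArea, vertexA, vertexB]

theorem isOpen_triangleT (hJ : 0 < α * Real.sin θ) : IsOpen (triangleT α θ) :=
  isOpen_openTriangle (by rwa [signedArea_triangleT])

theorem isBounded_triangleT (α θ : ℝ) : Bornology.IsBounded (triangleT α θ) :=
  isBounded_openTriangle _ _ _

theorem fderiv_apply_eq_coord (φ : ℝ × ℝ → ℝ) (x y : ℝ × ℝ) :
    fderiv ℝ φ x y = y.1 * fderiv ℝ φ x (1, 0) + y.2 * fderiv ℝ φ x (0, 1) := by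
  have h : y = y.1 • ((1, 0) : ℝ × ℝ) + y.2 • ((0, 1) : ℝ × ℝ) := by ext <;> simp
  calc fderiv ℝ φ x y = fderiv ℝ φ x (y.1 • ((1, 0) : ℝ × ℝ) + y.2 • ((0, 1) : ℝ × ℝ)) := by
        rw [← h]
    _ = _ := by rw [map_add, map_smul, map_smul, smul_eq_mul, smul_eq_mul]

theorem integral_add_three {X : Type*} [MeasurableSpace X] {μ : Measure X} {f g h : X → ℝ}
    (hf : Integrable f μ) (hg : Integrable g μ) (hh : Integrable h μ) :
    ∫ x, (f x + g x + h x) ∂μ = (∫ x, f x ∂μ) + (∫ x, g x ∂μ) + ∫ x, h x ∂μ := by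
  rw [integral_add (f := fun x => f x + g x) (hf.add hg) hh, integral_add hf hg]

theorem integral_edge (hJ : 0 < α * Real.sin θ) (i : Fin 3) {φ : ℝ × ℝ → ℝ}
    (hφ : ContDiff ℝ (⊤ : ℕ∞) φ) :
    ∫ x in triangleT α θ, (fderiv ℝ φ x (x - edgeApex α θ i) + 2 * φ x)
      = α * Real.sin θ * ∫ t in (0 : ℝ)..1, φ (edgePoint α θ i t) := by
  rw [← signedArea_edge α θ i] at hJ
  rw [← openTriangle_edge α θ i, integral_openTriangle_fderiv hJ hφ, signedArea_edge]
  rfl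

/-- The continuous linear functional on `H¹(T_{α,θ})` that extends
`φ ↦ α sin θ ∫₀¹ φ (edgePoint α θ i t) dt`. -/
noncomputable def edgeFunctional (α θ : ℝ) (i : Fin 3) (v : ℝ × ℝ → ℝ) : ℝ :=
  (∫ x in triangleT α θ, (x.1 - (edgeApex α θ i).1) * weakDeriv (triangleT α θ) (1, 0) v x)
    + (∫ x in triangleT α θ, (x.2 - (edgeApex α θ i).2) * weakDeriv (triangleT α θ) (0, 1) v x)
    + ∫ x in triangleT α θ, 2 * v x

theorem memLp_fst_sub (α θ c : ℝ) :
    MemLp (fun x : ℝ × ℝ => x.1 - c) 2 (volume.restrict (triangleT α θ)) :=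
  memLp_of_continuous_of_isBounded (isBounded_triangleT α θ) (by fun_prop)

theorem memLp_snd_sub (α θ c : ℝ) :
    MemLp (fun x : ℝ × ℝ => x.2 - c) 2 (volume.restrict (triangleT α θ)) :=
  memLp_of_continuous_of_isBounded (isBounded_triangleT α θ) (by fun_prop)

theorem memLp_triangleT_const (α θ c : ℝ) :
    MemLp (fun _ : ℝ × ℝ => c) 2 (volume.restrict (triangleT α θ)) :=
  memLp_of_continuous_of_isBounded (isBounded_triangleT α θ) continuous_const

theorem memLp_triangleT_of_contDiff (α θ : ℝ) {φ : ℝ × ℝ → ℝ} (hφ : ContDiff ℝ (⊤ : ℕ∞) φ) :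
    MemLp φ 2 (volume.restrict (triangleT α θ)) :=
  memLp_of_continuous_of_isBounded (isBounded_triangleT α θ) hφ.continuous

theorem memLp_triangleT_fderiv (α θ : ℝ) {φ : ℝ × ℝ → ℝ} (hφ : ContDiff ℝ (⊤ : ℕ∞) φ)
    (e : ℝ × ℝ) : MemLp (fun x => fderiv ℝ φ x e) 2 (volume.restrict (triangleT α θ)) :=
  (isWeakDeriv_of_contDiff (isBounded_triangleT α θ) hφ e).1

theorem integral_edge_eq_sum (hJ : 0 < α * Real.sin θ) (i : Fin 3) {φ : ℝ × ℝ → ℝ}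
    (hφ : ContDiff ℝ (⊤ : ℕ∞) φ) :
    α * Real.sin θ * ∫ t in (0 : ℝ)..1, φ (edgePoint α θ i t)
      = (∫ x in triangleT α θ, (x.1 - (edgeApex α θ i).1) * fderiv ℝ φ x (1, 0))
        + (∫ x in triangleT α θ, (x.2 - (edgeApex α θ i).2) * fderiv ℝ φ x (0, 1))
        + ∫ x in triangleT α θ, 2 * φ x := by
  have i1 : Integrable (fun x => (x.1 - (edgeApex α θ i).1) * fderiv ℝ φ x (1, 0))
      (volume.restrict (triangleT α θ)) :=
    (memLp_fst_sub α θ _).integrable_mul (memLp_triangleT_fderiv α θ hφ _)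
  have i2 : Integrable (fun x => (x.2 - (edgeApex α θ i).2) * fderiv ℝ φ x (0, 1))
      (volume.restrict (triangleT α θ)) :=
    (memLp_snd_sub α θ _).integrable_mul (memLp_triangleT_fderiv α θ hφ _)
  have i3 : Integrable (fun x => 2 * φ x) (volume.restrict (triangleT α θ)) :=
    (memLp_triangleT_const α θ 2).integrable_mul (memLp_triangleT_of_contDiff α θ hφ)
  rw [← integral_add_three i1 i2 i3, ← integral_edge hJ i hφ]
  refine integral_congr_ae (Filter.Eventually.of_forall fun x => ?_)
  simp only
  rw [fderiv_apply_eq_coord]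
  simp

theorem edgeFunctional_of_contDiff (hJ : 0 < α * Real.sin θ) (i : Fin 3) {φ : ℝ × ℝ → ℝ}
    (hφ : ContDiff ℝ (⊤ : ℕ∞) φ) :
    edgeFunctional α θ i φ = α * Real.sin θ * ∫ t in (0 : ℝ)..1, φ (edgePoint α θ i t) := by
  have hw := fun e : ℝ × ℝ => (isWeakDeriv_of_contDiff (isBounded_triangleT α θ) hφ
    e).weakDeriv_ae_eq (isOpen_triangleT hJ)
  rw [integral_edge_eq_sum hJ i hφ, edgeFunctional]
  congr 2
  · exact integral_congr_ae ((hw (1, 0)).mono fun x hx => by simp [hx])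
  · exact integral_congr_ae ((hw (0, 1)).mono fun x hx => by simp [hx])

theorem edgeFunctional_linear (hJ : 0 < α * Real.sin θ) (i : Fin 3) {v w : ℝ × ℝ → ℝ}
    (hv : MemH1 (triangleT α θ) v) (hw : MemH1 (triangleT α θ) w) (a b : ℝ) :
    edgeFunctional α θ i (fun x => a * v x + b * w x)
      = a * edgeFunctional α θ i v + b * edgeFunctional α θ i w := by
  have key : ∀ {f g k l : ℝ × ℝ → ℝ}, MemLp f 2 (volume.restrict (triangleT α θ)) →
      MemLp g 2 (volume.restrict (triangleT α θ)) → MemLp k 2 (volume.restrict (triangleT α θ)) →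
      l =ᵐ[volume.restrict (triangleT α θ)] (fun x => a * f x + b * g x) →
      ∫ x in triangleT α θ, k x * l x
        = a * (∫ x in triangleT α θ, k x * f x) + b * ∫ x in triangleT α θ, k x * g x := by
    intro f g k l hf hg hk hl
    rw [← integral_const_mul, ← integral_const_mul, ← integral_add
      (f := fun x => a * (k x * f x)) (g := fun x => b * (k x * g x))
      ((hk.integrable_mul hf).const_mul a) ((hk.integrable_mul hg).const_mul b)]
    exact integral_congr_ae (hl.mono fun x hx => by simp only [hx]; ring)
  have hU := isOpen_triangleT hJ
  have m1 : ((1, 0) : ℝ × ℝ) ∈ ({(1, 0), (0, 1)} : Set (ℝ × ℝ)) := by simp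
  have m2 : ((0, 1) : ℝ × ℝ) ∈ ({(1, 0), (0, 1)} : Set (ℝ × ℝ)) := by simp
  unfold edgeFunctional
  rw [key (hv.isWeakDeriv m1).1 (hw.isWeakDeriv m1).1 (memLp_fst_sub α θ _)
      (hv.weakDeriv_linear hU hw m1 a b),
    key (hv.isWeakDeriv m2).1 (hw.isWeakDeriv m2).1 (memLp_snd_sub α θ _)
      (hv.weakDeriv_linear hU hw m2 a b),
    key hv.1 hw.1 (memLp_triangleT_const α θ 2) (Filter.EventuallyEq.refl _ _)]
  ring

/-- Each term pairs a fixed L² weight with an L²-convergent sequence, so the limit is the same for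
every smooth approximation of v. -/
theorem tendsto_edgeFunctional (hJ : 0 < α * Real.sin θ) (i : Fin 3) {v : ℝ × ℝ → ℝ}
    (hv : MemH1 (triangleT α θ) v) {φ : ℕ → ℝ × ℝ → ℝ} (hφ : ∀ n, ContDiff ℝ (⊤ : ℕ∞) (φ n))
    (h0 : Filter.Tendsto (fun n => l2Norm (triangleT α θ) (fun x => v x - φ n x))
      Filter.atTop (nhds 0))
    (h1 : ∀ e ∈ ({(1, 0), (0, 1)} : Set (ℝ × ℝ)),
      Filter.Tendsto (fun n => l2Norm (triangleT α θ)
        (fun x => weakDeriv (triangleT α θ) e v x - fderiv ℝ (φ n) x e)) Filter.atTop (nhds 0)) :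
    Filter.Tendsto (fun n => α * Real.sin θ * ∫ t in (0 : ℝ)..1, φ n (edgePoint α θ i t))
      Filter.atTop (nhds (edgeFunctional α θ i v)) := by
  simp only [integral_edge_eq_sum hJ i (hφ _)]
  have m1 : ((1, 0) : ℝ × ℝ) ∈ ({(1, 0), (0, 1)} : Set (ℝ × ℝ)) := by simp
  have m2 : ((0, 1) : ℝ × ℝ) ∈ ({(1, 0), (0, 1)} : Set (ℝ × ℝ)) := by simp
  refine Filter.Tendsto.add (Filter.Tendsto.add ?_ ?_) ?_
  · exact tendsto_integral_mul_of_tendsto_sqrt_integral_sq (memLp_fst_sub α θ _)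
      (hv.isWeakDeriv m1).1 (fun n => memLp_triangleT_fderiv α θ (hφ n) _) (h1 _ m1)
  · exact tendsto_integral_mul_of_tendsto_sqrt_integral_sq (memLp_snd_sub α θ _)
      (hv.isWeakDeriv m2).1 (fun n => memLp_triangleT_fderiv α θ (hφ n) _) (h1 _ m2)
  · exact tendsto_integral_mul_of_tendsto_sqrt_integral_sq (memLp_triangleT_const α θ 2)
      hv.1 (fun n => memLp_triangleT_of_contDiff α θ (hφ n)) h0

theorem continuous_edgePoint (α θ : ℝ) (i : Fin 3) : Continuous (edgePoint α θ i) := by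
  unfold edgePoint
  fun_prop

theorem memLp_edge (i : Fin 3) {φ : ℝ × ℝ → ℝ} (hφ : Continuous φ) :
    MemLp (fun t => φ (edgePoint α θ i t)) 2 (volume.restrict (Set.Ioc (0 : ℝ) 1)) := by
  have hc := hφ.comp (continuous_edgePoint α θ i)
  obtain ⟨C, hC⟩ := (isCompact_Icc (a := (0 : ℝ)) (b := 1)).exists_bound_of_continuousOn
    hc.continuousOn
  exact MemLp.of_bound hc.aestronglyMeasurable C ((ae_restrict_iff' measurableSet_Ioc).2
    (Filter.Eventually.of_forall fun t ht => hC t (Set.Ioc_subset_Icc_self ht)))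

/-- Both sides are limits of the edge means of the same smooth functions. Hence all traces of v on
an edge have the same integral. -/
theorem IsTrace.integral_eq (hJ : 0 < α * Real.sin θ) {i : Fin 3} {v : ℝ × ℝ → ℝ} {g : ℝ → ℝ}
    (h : IsTrace α θ i v g) :
    α * Real.sin θ * ∫ t in (0 : ℝ)..1, g t = edgeFunctional α θ i v := by
  obtain ⟨hv, hg, φ, hφ, h0, h1, h2⟩ := h
  refine tendsto_nhds_unique ?_ (tendsto_edgeFunctional hJ i hv hφ h0 h1)
  refine Filter.Tendsto.const_mul _ ?_
  have h3 := h2.sqrt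
  simp only [intervalIntegral.integral_of_le zero_le_one, Real.sqrt_zero] at h3 ⊢
  have h4 := tendsto_integral_mul_of_tendsto_sqrt_integral_sq
    (memLp_const (1 : ℝ) (μ := volume.restrict (Set.Ioc (0 : ℝ) 1))) hg
    (fun n => memLp_edge i (hφ n).continuous) h3
  simpa using h4

/-- The trace inequality for smooth functions. -/
theorem exists_trace_le (hJ : 0 < α * Real.sin θ) (i : Fin 3) :
    ∃ C : ℝ, 0 ≤ C ∧ ∀ φ : ℝ × ℝ → ℝ, ContDiff ℝ (⊤ : ℕ∞) φ →
      Real.sqrt (∫ t in (0 : ℝ)..1, φ (edgePoint α θ i t) ^ 2)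
        ≤ C * (l2Norm (triangleT α θ) φ
          + l2Norm (triangleT α θ) (fun x => fderiv ℝ φ x (1, 0))
          + l2Norm (triangleT α θ) (fun x => fderiv ℝ φ x (0, 1))) := by
  obtain ⟨D, hD⟩ := (isBounded_triangleT α θ).exists_norm_le
  set P := edgeApex α θ i with hP
  set K : ℝ := |D| + ‖P‖ with hK
  have hK0 : 0 ≤ K := by positivity
  have hxP : ∀ x ∈ triangleT α θ, |x.1 - P.1| ≤ K ∧ |x.2 - P.2| ≤ K := by
    intro x hx
    have h1 : ‖x - P‖ ≤ K := (norm_sub_le x P).trans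
      (add_le_add ((hD x hx).trans (le_abs_self D)) le_rfl)
    exact ⟨(norm_fst_le (x - P)).trans h1, (norm_snd_le (x - P)).trans h1⟩
  refine ⟨Real.sqrt ((2 * K + 2) / (α * Real.sin θ)), Real.sqrt_nonneg _, fun φ hφ => ?_⟩
  set T := triangleT α θ with hT
  have hUm : MeasurableSet T := (isOpen_triangleT hJ).measurableSet
  have hφ2 := memLp_triangleT_of_contDiff α θ hφ
  have hd1 := memLp_triangleT_fderiv α θ hφ (1, 0)
  have hd2 := memLp_triangleT_fderiv α θ hφ (0, 1)
  have hsq : ContDiff ℝ (⊤ : ℕ∞) fun x => φ x ^ 2 := hφ.pow 2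
  -- The divergence identity for φ² expresses the squared edge norm as an integral of 2φ∇φ·(x - P) +
  -- 2φ², which is then bounded pointwise using |2pq| ≤ p² + q².
  have hid := integral_edge hJ i hsq
  have hfd : ∀ x y, fderiv ℝ (fun x => φ x ^ 2) x y = 2 * φ x * fderiv ℝ φ x y := by
    intro x y
    have := ((hφ.differentiable (by simp) x).hasFDerivAt.pow 2).fderiv
    rw [this]
    simp
  have hle : α * Real.sin θ * ∫ t in (0 : ℝ)..1, φ (edgePoint α θ i t) ^ 2
      ≤ (2 * K + 2) * ((∫ x in T, φ x ^ 2) + (∫ x in T, fderiv ℝ φ x (1, 0) ^ 2)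
        + ∫ x in T, fderiv ℝ φ x (0, 1) ^ 2) := by
    rw [← hid, ← integral_add_three hφ2.integrable_sq hd1.integrable_sq hd2.integrable_sq,
      ← integral_const_mul]
    have hI : Integrable (fun x => fderiv ℝ (fun x => φ x ^ 2) x (x - P) + 2 * φ x ^ 2)
        (volume.restrict T) := by
      have hc : Continuous fun x => fderiv ℝ (fun x => φ x ^ 2) x (x - P) + 2 * φ x ^ 2 :=
        ((hsq.continuous_fderiv (by simp)).clm_apply (by fun_prop)).add
          (hsq.continuous.const_mul 2)
      have : IsFiniteMeasure (volume.restrict T) :=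
        ⟨by simpa using (isBounded_triangleT α θ).measure_lt_top⟩
      exact (memLp_of_continuous_of_isBounded (isBounded_triangleT α θ) hc).integrable
        (by norm_num)
    refine setIntegral_mono_on hI
      (((hφ2.integrable_sq.add hd1.integrable_sq).add hd2.integrable_sq).const_mul _) hUm ?_
    intro x hx
    rw [hfd, fderiv_apply_eq_coord φ x (x - P)]
    obtain ⟨hx1, hx2⟩ := hxP x hx
    simp only [Prod.fst_sub, Prod.snd_sub]
    set p := φ x
    set d := fderiv ℝ φ x (1, 0)
    set k := fderiv ℝ φ x (0, 1)
    have key : ∀ s q : ℝ, |s| ≤ K → 2 * p * (s * q) ≤ K * (p ^ 2 + q ^ 2) := by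
      intro s q hs
      have h1 : 2 * p * (s * q) ≤ |s| * (2 * |p * q|) := by
        calc 2 * p * (s * q) ≤ |2 * p * (s * q)| := le_abs_self _
          _ = |s| * (2 * |p * q|) := by simp only [abs_mul, abs_two]; ring
      have h2 : 2 * |p * q| ≤ p ^ 2 + q ^ 2 := by
        rw [abs_mul, ← sq_abs p, ← sq_abs q]
        nlinarith [sq_nonneg (|p| - |q|)]
      calc _ ≤ |s| * (2 * |p * q|) := h1
        _ ≤ K * (p ^ 2 + q ^ 2) := by gcongr
    nlinarith [key _ d hx1, key _ k hx2, mul_nonneg hK0 (sq_nonneg d),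
      mul_nonneg hK0 (sq_nonneg k), sq_nonneg d, sq_nonneg k]
  have hle2 : ∫ t in (0 : ℝ)..1, φ (edgePoint α θ i t) ^ 2
      ≤ (2 * K + 2) / (α * Real.sin θ) * (l2Norm T φ + l2Norm T (fun x => fderiv ℝ φ x (1, 0))
          + l2Norm T (fun x => fderiv ℝ φ x (0, 1))) ^ 2 := by
    rw [div_mul_eq_mul_div, le_div_iff₀ hJ, mul_comm]
    refine hle.trans (mul_le_mul_of_nonneg_left ?_ (by positivity))
    have e : ∀ f : ℝ × ℝ → ℝ, ∫ x in T, f x ^ 2 = l2Norm T f ^ 2 := fun f =>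
      (Real.sq_sqrt (integral_nonneg fun _ => sq_nonneg _)).symm
    rw [e φ, e fun x => fderiv ℝ φ x (1, 0), e fun x => fderiv ℝ φ x (0, 1)]
    have n1 : 0 ≤ l2Norm T φ := Real.sqrt_nonneg _
    have n2 : 0 ≤ l2Norm T (fun x => fderiv ℝ φ x (1, 0)) := Real.sqrt_nonneg _
    have n3 : 0 ≤ l2Norm T (fun x => fderiv ℝ φ x (0, 1)) := Real.sqrt_nonneg _
    nlinarith [mul_nonneg n1 n2, mul_nonneg n1 n3, mul_nonneg n2 n3]
  refine (Real.sqrt_le_sqrt hle2).trans_eq ?_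
  rw [Real.sqrt_mul (by positivity), Real.sqrt_sq]
  exact add_nonneg (add_nonneg (Real.sqrt_nonneg _) (Real.sqrt_nonneg _)) (Real.sqrt_nonneg _)

theorem l2Norm_sub_le_add {f g h : ℝ × ℝ → ℝ} {U : Set (ℝ × ℝ)}
    (hf : MemLp f 2 (volume.restrict U)) (hg : MemLp g 2 (volume.restrict U))
    (hh : MemLp h 2 (volume.restrict U)) :
    l2Norm U (fun x => g x - h x) ≤ l2Norm U (fun x => f x - g x) + l2Norm U (fun x => f x - h x)
    := by
  have h1 := sqrt_integral_sq_add_le ((hf.sub hg).neg) (hf.sub hh)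
  simp only [Pi.neg_apply, Pi.sub_apply, neg_sq] at h1
  refine le_trans (le_of_eq ?_) h1
  unfold l2Norm
  congr 1
  exact integral_congr_ae (Filter.Eventually.of_forall fun x => by ring)

/-- By the trace inequality applied to differences, the edge restrictions of an H¹ approximation are
Cauchy in L²(0, 1); their limit is the trace. -/
theorem MemH1.exists_isTrace (hJ : 0 < α * Real.sin θ) (i : Fin 3) {v : ℝ × ℝ → ℝ}
    (hv : MemH1 (triangleT α θ) v) : ∃ g, IsTrace α θ i v g := by
  obtain ⟨φ, hφ, h0, h1⟩ := exists_contDiff_tendsto (isOpen_triangleT hJ)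
    (convex_openTriangle _ _ _) (isBounded_triangleT α θ) (nonempty_openTriangle _ _ _) hv.1
  have h1' := fun e (he : e ∈ ({(1, 0), (0, 1)} : Set (ℝ × ℝ))) => h1 e _ (hv.isWeakDeriv he)
  obtain ⟨C, hC0, hC⟩ := exists_trace_le hJ i
  have m1 : ((1, 0) : ℝ × ℝ) ∈ ({(1, 0), (0, 1)} : Set (ℝ × ℝ)) := by simp
  have m2 : ((0, 1) : ℝ × ℝ) ∈ ({(1, 0), (0, 1)} : Set (ℝ × ℝ)) := by simp
  set T := triangleT α θ with hT
  set B : ℕ → ℝ := fun n => C * (l2Norm T (fun x => v x - φ n x)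
    + l2Norm T (fun x => weakDeriv T (1, 0) v x - fderiv ℝ (φ n) x (1, 0))
    + l2Norm T (fun x => weakDeriv T (0, 1) v x - fderiv ℝ (φ n) x (0, 1))) with hB
  have hBlim : Filter.Tendsto B Filter.atTop (nhds 0) := by
    simpa using ((h0.add (h1' _ m1)).add (h1' _ m2)).const_mul C
  have hcau : ∀ n m, Real.sqrt (∫ t in Set.Ioc (0 : ℝ) 1,
      (φ n (edgePoint α θ i t) - φ m (edgePoint α θ i t)) ^ 2) ≤ B n + B m := by
    intro n m
    have h2 := hC (fun x => φ n x - φ m x) ((hφ n).sub (hφ m))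
    rw [intervalIntegral.integral_of_le zero_le_one] at h2
    refine h2.trans ?_
    rw [hB, ← mul_add]
    refine mul_le_mul_of_nonneg_left ?_ hC0
    have hfd : ∀ e : ℝ × ℝ, (fun x => fderiv ℝ (fun x => φ n x - φ m x) x e)
        = fun x => fderiv ℝ (φ n) x e - fderiv ℝ (φ m) x e := by
      intro e
      funext x
      rw [fderiv_fun_sub ((hφ n).differentiable (by simp) x) ((hφ m).differentiable (by simp) x)]
      rfl
    rw [hfd, hfd]
    have k0 := l2Norm_sub_le_add hv.1 (memLp_triangleT_of_contDiff α θ (hφ n))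
      (memLp_triangleT_of_contDiff α θ (hφ m))
    have k1 := l2Norm_sub_le_add (hv.isWeakDeriv m1).1
      (memLp_triangleT_fderiv α θ (hφ n) (1, 0)) (memLp_triangleT_fderiv α θ (hφ m) (1, 0))
    have k2 := l2Norm_sub_le_add (hv.isWeakDeriv m2).1
      (memLp_triangleT_fderiv α θ (hφ n) (0, 1)) (memLp_triangleT_fderiv α θ (hφ m) (0, 1))
    linarith
  obtain ⟨g, hg, hglim⟩ := exists_tendsto_sqrt_integral_sq
    (fun n => memLp_edge i (hφ n).continuous) hBlim hcau
  refine ⟨g, hv, hg, φ, hφ, h0, h1', ?_⟩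
  simpa only [intervalIntegral.integral_of_le zero_le_one] using hglim

/-- From here on traces are replaced by the linear functional `edgeFunctional`. -/
theorem hasEdgeIntegral_iff (hJ : 0 < α * Real.sin θ) (i : Fin 3) {v : ℝ × ℝ → ℝ}
    (hv : MemH1 (triangleT α θ) v) {I : ℝ} :
    HasEdgeIntegral α θ i v I
      ↔ edgeLength α θ i * (edgeFunctional α θ i v / (α * Real.sin θ)) = I := by
  have h : ∀ g, IsTrace α θ i v g →
      ∫ t in (0 : ℝ)..1, g t = edgeFunctional α θ i v / (α * Real.sin θ) := by
    intro g hg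
    rw [← hg.integral_eq hJ, mul_div_cancel_left₀ _ hJ.ne']
  constructor
  · rintro ⟨g, hg, rfl⟩
    rw [h g hg]
  · rintro rfl
    obtain ⟨g, hg⟩ := hv.exists_isTrace hJ i
    exact ⟨g, hg, by rw [h g hg]⟩

end Edge

/-! ### A Poincaré inequality -/

section Poincare

theorem ofReal_sq_eq_enorm_sq (a : ℝ) : ENNReal.ofReal (a ^ 2) = ‖a‖ₑ ^ 2 := by
  rw [← sq_abs, ENNReal.ofReal_pow (abs_nonneg a), Real.enorm_eq_ofReal_abs]

/-- Integrating the gradient only up to the midpoint keeps 1 - s ≥ 1/2, so the later substitution (1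
- s)x + sy in the variable x has a Jacobian bounded away from zero. -/
theorem enorm_sub_midpoint_sq_le {φ : ℝ × ℝ → ℝ} (hφ : ContDiff ℝ (⊤ : ℕ∞) φ) (x y : ℝ × ℝ) :
    ENNReal.ofReal ((φ x - φ ((1 / 2 : ℝ) • x + (1 / 2 : ℝ) • y)) ^ 2)
      ≤ ‖y - x‖ₑ ^ 2 * ∫⁻ s in Set.Ioc (0 : ℝ) (1 / 2),
        ‖fderiv ℝ φ ((1 - s) • x + s • y)‖ₑ ^ 2 := by
  have hφ' := hφ.continuous_fderiv (n := (⊤ : ℕ∞)) (by simp)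
  have hp : Continuous fun s : ℝ => (1 - s) • x + s • y := by fun_prop
  have hder : ∀ s : ℝ, HasDerivAt (fun s : ℝ => φ ((1 - s) • x + s • y))
      (fderiv ℝ φ ((1 - s) • x + s • y) (y - x)) s := by
    intro s
    have h1 : HasDerivAt (fun s : ℝ => (1 - s) • x + s • y) (y - x) s := by
      have h2 := (((hasDerivAt_id s).const_sub 1).smul_const x).add
        ((hasDerivAt_id s).smul_const y)
      exact h2.congr_deriv (by module)
    exact (hφ.differentiable (by simp) _).hasFDerivAt.comp_hasDerivAt s h1
  have hftc := intervalIntegral.integral_eq_sub_of_hasDerivAt (a := 0) (b := 1 / 2)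
    (fun s _ => hder s)
    (((hφ'.comp hp).clm_apply continuous_const).intervalIntegrable _ _)
  rw [intervalIntegral.integral_of_le (by norm_num)] at hftc
  have hx0 : (1 - (0 : ℝ)) • x + (0 : ℝ) • y = x := by simp
  have hx1 : (1 - (1 / 2 : ℝ)) • x + (1 / 2 : ℝ) • y = (1 / 2 : ℝ) • x + (1 / 2 : ℝ) • y := by
    norm_num
  rw [hx0, hx1] at hftc
  rw [ofReal_sq_eq_enorm_sq, enorm_sub_rev, ← hftc]
  have h1 : ‖∫ s in Set.Ioc (0 : ℝ) (1 / 2), fderiv ℝ φ ((1 - s) • x + s • y) (y - x)‖ₑ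
      ≤ ∫⁻ s in Set.Ioc (0 : ℝ) (1 / 2), ‖y - x‖ₑ * ‖fderiv ℝ φ ((1 - s) • x + s • y)‖ₑ := by
    refine (enorm_integral_le_lintegral_enorm _).trans (lintegral_mono fun s => ?_)
    rw [mul_comm]
    exact ContinuousLinearMap.le_opENorm _ _
  have hm : Measurable fun s : ℝ => ‖fderiv ℝ φ ((1 - s) • x + s • y)‖ₑ :=
    (hφ'.comp hp).measurable.enorm
  refine (pow_le_pow_left₀ zero_le h1 2).trans
    ((lintegral_mul_sq_le (by fun_prop) hm.aemeasurable).trans ?_)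
  gcongr
  rw [lintegral_const, Measure.restrict_apply MeasurableSet.univ, Set.univ_inter, Real.volume_Ioc]
  refine mul_le_of_le_one_right zero_le ?_
  rw [ENNReal.ofReal_le_one]
  norm_num

/-- The mean square oscillation over a bounded convex set is controlled by the gradient. -/
theorem lintegral_lintegral_sub_sq_le {U : Set (ℝ × ℝ)} (hU : MeasurableSet U)
    (hUc : Convex ℝ U) {D : ENNReal} (hD : ∀ x ∈ U, ∀ y ∈ U, ‖y - x‖ₑ ≤ D) {φ : ℝ × ℝ → ℝ}
    (hφ : ContDiff ℝ (⊤ : ℕ∞) φ) :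
    ∫⁻ x in U, ∫⁻ y in U, ENNReal.ofReal ((φ x - φ y) ^ 2)
      ≤ 16 * D ^ 2 * volume U * ∫⁻ x in U, ‖fderiv ℝ φ x‖ₑ ^ 2 := by
  have hφ' := hφ.continuous_fderiv (n := (⊤ : ℕ∞)) (by simp)
  have hφc := hφ.continuous
  set F : ℝ × ℝ → ENNReal := U.indicator fun x => ‖fderiv ℝ φ x‖ₑ ^ 2 with hF
  have hFm : Measurable F := (hφ'.measurable.enorm.pow_const 2).indicator hU
  have hFint : ∫⁻ x, F x = ∫⁻ x in U, ‖fderiv ℝ φ x‖ₑ ^ 2 := lintegral_indicator hU _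
  set H : ℝ × ℝ → ℝ × ℝ → ENNReal := fun x y =>
    ∫⁻ s in Set.Ioc (0 : ℝ) (1 / 2), F ((1 - s) • x + s • y) with hH
  have hHm : Measurable (Function.uncurry H) := by
    have : Measurable fun p : (ℝ × ℝ) × ℝ × ℝ =>
        ∫⁻ s in Set.Ioc (0 : ℝ) (1 / 2), F ((1 - s) • p.1 + s • p.2) := by fun_prop
    exact this
  have hmid : ∀ x ∈ U, ∀ y ∈ U,
      ENNReal.ofReal ((φ x - φ ((1 / 2 : ℝ) • x + (1 / 2 : ℝ) • y)) ^ 2) ≤ D ^ 2 * H x y := by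
    intro x hx y hy
    refine (enorm_sub_midpoint_sq_le hφ x y).trans ?_
    have h1 := hD x hx y hy
    gcongr
    refine lintegral_mono_ae ((ae_restrict_iff' measurableSet_Ioc).2
      (Filter.Eventually.of_forall fun s hs => ?_))
    have hmem : (1 - s) • x + s • y ∈ U :=
      hUc hx hy (by linarith [hs.2]) hs.1.le (by ring)
    rw [hF, Set.indicator_of_mem hmem]
  -- Both end points are compared with the common midpoint.
  have hpt : ∀ x ∈ U, ∀ y ∈ U, ENNReal.ofReal ((φ x - φ y) ^ 2)
      ≤ 2 * D ^ 2 * H x y + 2 * D ^ 2 * H y x := by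
    intro x hx y hy
    have h1 := hmid x hx y hy
    have h2 := hmid y hy x hx
    rw [add_comm ((1 / 2 : ℝ) • y)] at h2
    set m := φ ((1 / 2 : ℝ) • x + (1 / 2 : ℝ) • y)
    calc ENNReal.ofReal ((φ x - φ y) ^ 2)
        ≤ ENNReal.ofReal (2 * (φ x - m) ^ 2 + 2 * (φ y - m) ^ 2) := by
          refine ENNReal.ofReal_le_ofReal ?_
          nlinarith [sq_nonneg ((φ x - m) + (φ y - m))]
      _ = 2 * ENNReal.ofReal ((φ x - m) ^ 2) + 2 * ENNReal.ofReal ((φ y - m) ^ 2) := by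
          rw [ENNReal.ofReal_add (by positivity) (by positivity),
            ENNReal.ofReal_mul (by norm_num), ENNReal.ofReal_mul (by norm_num),
            ENNReal.ofReal_ofNat]
      _ ≤ 2 * (D ^ 2 * H x y) + 2 * (D ^ 2 * H y x) := by gcongr
      _ = _ := by ring
  have hHint : ∫⁻ x in U, ∫⁻ y in U, H y x ≤ 4 * volume U * ∫⁻ x, F x := by
    have h1 : ∀ x : ℝ × ℝ, ∫⁻ y in U, H y x ≤ 4 * ∫⁻ x, F x := by
      intro x
      -- The map y ↦ (1 - s)y + sx scales areas by (1 - s)² ≥ 1/4. Since F is extended by zero,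
      -- integrating over the whole plane loses nothing.
      have h2 : ∀ s ∈ Set.Ioc (0 : ℝ) (1 / 2), ∫⁻ y in U, F ((1 - s) • y + s • x)
          ≤ 4 * ∫⁻ x, F x := by
        intro s hs
        refine (setLIntegral_le_lintegral _ _).trans ?_
        rw [lintegral_comp_smul_add hFm (by linarith [hs.2])]
        gcongr
        rw [show (4 : ENNReal) = ENNReal.ofReal 4 by simp]
        refine ENNReal.ofReal_le_ofReal (inv_le_of_inv_le₀ (by norm_num) ?_)
        nlinarith [hs.2]
      rw [hH, lintegral_lintegral_swap (by fun_prop)]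
      refine (lintegral_mono_ae ((ae_restrict_iff' measurableSet_Ioc).2
        (Filter.Eventually.of_forall h2))).trans ?_
      rw [lintegral_const, Measure.restrict_apply MeasurableSet.univ, Set.univ_inter,
        Real.volume_Ioc]
      refine mul_le_of_le_one_right zero_le ?_
      rw [ENNReal.ofReal_le_one]
      norm_num
    refine (lintegral_mono h1).trans_eq ?_
    rw [lintegral_const, Measure.restrict_apply MeasurableSet.univ, Set.univ_inter]
    ring
  have hHint' : ∫⁻ x in U, ∫⁻ y in U, H x y ≤ 4 * volume U * ∫⁻ x, F x := by
    rw [lintegral_lintegral_swap hHm.aemeasurable]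
    exact hHint
  have hH1 : ∀ x, Measurable fun y => H x y := fun x => hHm.comp measurable_prodMk_left
  have hH2 : ∀ x, Measurable fun y => H y x := fun x => hHm.comp measurable_prodMk_right
  have hH3 : Measurable fun x => ∫⁻ y in U, H x y := hHm.lintegral_prod_right'
  have hH4 : Measurable fun x => ∫⁻ y in U, H y x := hHm.lintegral_prod_left'
  calc ∫⁻ x in U, ∫⁻ y in U, ENNReal.ofReal ((φ x - φ y) ^ 2)
      ≤ ∫⁻ x in U, ∫⁻ y in U, (2 * D ^ 2 * H x y + 2 * D ^ 2 * H y x) := by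
        refine lintegral_mono_ae ((ae_restrict_iff' hU).2 (Filter.Eventually.of_forall ?_))
        intro x hx
        exact lintegral_mono_ae ((ae_restrict_iff' hU).2
          (Filter.Eventually.of_forall fun y hy => hpt x hx y hy))
    _ = 2 * D ^ 2 * (∫⁻ x in U, ∫⁻ y in U, H x y)
          + 2 * D ^ 2 * ∫⁻ x in U, ∫⁻ y in U, H y x := by
        rw [← lintegral_const_mul _ hH3, ← lintegral_const_mul _ hH4,
          ← lintegral_add_left (hH3.const_mul _)]
        refine lintegral_congr fun x => ?_
        rw [lintegral_add_left ((hH1 x).const_mul _), lintegral_const_mul _ (hH1 x),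
          lintegral_const_mul _ (hH2 x)]
    _ ≤ 2 * D ^ 2 * (4 * volume U * ∫⁻ x, F x) + 2 * D ^ 2 * (4 * volume U * ∫⁻ x, F x) := by
        gcongr
    _ = 16 * D ^ 2 * volume U * ∫⁻ x in U, ‖fderiv ℝ φ x‖ₑ ^ 2 := by
        rw [hFint]
        ring

variable {α θ : ℝ}

theorem measure_triangleT (hJ : 0 < α * Real.sin θ) :
    2 * volume.real (triangleT α θ) = α * Real.sin θ := by
  have h := integral_edge hJ 0 (φ := fun _ => (1 : ℝ)) contDiff_const
  simpa [mul_comm] using h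

/-- The operator norm is dual to the sup norm of the plane, so it is at most the sum of the absolute
values of the partial derivatives. -/
theorem lintegral_enorm_fderiv_sq_le {φ : ℝ × ℝ → ℝ} (hφ : ContDiff ℝ (⊤ : ℕ∞) φ) :
    ∫⁻ x in triangleT α θ, ‖fderiv ℝ φ x‖ₑ ^ 2
      ≤ ENNReal.ofReal (2 * (l2Norm (triangleT α θ) (fun x => fderiv ℝ φ x (1, 0))
        + l2Norm (triangleT α θ) (fun x => fderiv ℝ φ x (0, 1))) ^ 2) := by
  have hd1 := memLp_triangleT_fderiv α θ hφ (1, 0)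
  have hd2 := memLp_triangleT_fderiv α θ hφ (0, 1)
  have hpt : ∀ x, ‖fderiv ℝ φ x‖ₑ ^ 2
      ≤ ENNReal.ofReal (2 * fderiv ℝ φ x (1, 0) ^ 2 + 2 * fderiv ℝ φ x (0, 1) ^ 2) := by
    intro x
    have h1 : ‖fderiv ℝ φ x‖ ≤ |fderiv ℝ φ x (1, 0)| + |fderiv ℝ φ x (0, 1)| := by
      refine ContinuousLinearMap.opNorm_le_bound _ (by positivity) fun y => ?_
      rw [fderiv_apply_eq_coord, Real.norm_eq_abs, add_mul]
      refine (abs_add_le _ _).trans (add_le_add ?_ ?_)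
      · rw [abs_mul, mul_comm]
        exact mul_le_mul_of_nonneg_left (norm_fst_le y) (abs_nonneg _)
      · rw [abs_mul, mul_comm]
        exact mul_le_mul_of_nonneg_left (norm_snd_le y) (abs_nonneg _)
    rw [← ofReal_norm, ← ENNReal.ofReal_pow (norm_nonneg _)]
    refine ENNReal.ofReal_le_ofReal ((pow_le_pow_left₀ (norm_nonneg _) h1 2).trans ?_)
    rw [← sq_abs (fderiv ℝ φ x (1, 0)), ← sq_abs (fderiv ℝ φ x (0, 1))]
    nlinarith [sq_nonneg (|fderiv ℝ φ x (1, 0)| - |fderiv ℝ φ x (0, 1)|)]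
  refine (lintegral_mono hpt).trans ?_
  rw [← ofReal_integral_eq_lintegral_ofReal
    (f := fun x => 2 * fderiv ℝ φ x (1, 0) ^ 2 + 2 * fderiv ℝ φ x (0, 1) ^ 2)
    ((hd1.integrable_sq.const_mul 2).add (hd2.integrable_sq.const_mul 2))
    (Filter.Eventually.of_forall fun x => by simp only [Pi.zero_apply]; positivity)]
  refine ENNReal.ofReal_le_ofReal ?_
  rw [integral_add (hd1.integrable_sq.const_mul 2) (hd2.integrable_sq.const_mul 2),
    integral_const_mul, integral_const_mul]
  have e : ∀ f : ℝ × ℝ → ℝ, ∫ x in triangleT α θ, f x ^ 2 = l2Norm (triangleT α θ) f ^ 2 :=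
    fun f => (Real.sq_sqrt (integral_nonneg fun _ => sq_nonneg _)).symm
  rw [e fun x => fderiv ℝ φ x (1, 0), e fun x => fderiv ℝ φ x (0, 1)]
  have n2 : 0 ≤ l2Norm (triangleT α θ) (fun x => fderiv ℝ φ x (1, 0)) := Real.sqrt_nonneg _
  have n3 : 0 ≤ l2Norm (triangleT α θ) (fun x => fderiv ℝ φ x (0, 1)) := Real.sqrt_nonneg _
  nlinarith [mul_nonneg n2 n3]

/-- With m the edge mean, the divergence identity and α sin θ = 2|T| write α sin θ (φ(x) - m) as the
integral over y of 2(φ(x) - φ(y)) - ∇φ(y)·(y - P). The first term is the oscillation bounded above,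
the second is controlled by the gradient. -/
theorem exists_poincare_of_contDiff (hJ : 0 < α * Real.sin θ) (i : Fin 3) :
    ∃ K : ℝ, 0 ≤ K ∧ ∀ φ : ℝ × ℝ → ℝ, ContDiff ℝ (⊤ : ℕ∞) φ →
      l2Norm (triangleT α θ) (fun x => φ x - ∫ t in (0 : ℝ)..1, φ (edgePoint α θ i t))
        ≤ K * (l2Norm (triangleT α θ) (fun x => fderiv ℝ φ x (1, 0))
          + l2Norm (triangleT α θ) (fun x => fderiv ℝ φ x (0, 1))) := by
  set T := triangleT α θ with hT
  set P := edgeApex α θ i with hP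
  have hTm : MeasurableSet T := (isOpen_triangleT hJ).measurableSet
  have hV : volume T ≠ ⊤ := (isBounded_triangleT α θ).measure_lt_top.ne
  have hfin : IsFiniteMeasure (volume.restrict T) := ⟨by simpa using hV.lt_top⟩
  obtain ⟨D, hD⟩ := (isBounded_triangleT α θ).exists_norm_le
  set M : ℝ := 2 * |D| + ‖P‖ with hM
  have hM0 : 0 ≤ M := by positivity
  have hM1 : ∀ x ∈ T, ∀ y ∈ T, ‖y - x‖ₑ ≤ ENNReal.ofReal M := by
    intro x hx y hy
    rw [← ofReal_norm]
    refine ENNReal.ofReal_le_ofReal ?_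
    linarith [norm_sub_le y x, hD x hx, hD y hy, le_abs_self D, norm_nonneg P]
  have hM2 : ∀ y ∈ T, ‖y - P‖ₑ ≤ ENNReal.ofReal M := by
    intro y hy
    rw [← ofReal_norm]
    refine ENNReal.ofReal_le_ofReal ?_
    linarith [norm_sub_le y P, hD y hy, le_abs_self D, abs_nonneg D]
  -- The 8 and 2 come from (2p - q)² ≤ 8p² + 2q², the 16 from the oscillation bound, and the outer
  -- volume from Cauchy–Schwarz against 1.
  set E : ENNReal := volume T * (8 * (16 * ENNReal.ofReal M ^ 2 * volume T)
    + 2 * ENNReal.ofReal M ^ 2 * volume T) with hE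
  have hEt : E ≠ ⊤ := by finiteness
  refine ⟨Real.sqrt (2 * E.toReal) / (α * Real.sin θ), by positivity, fun φ hφ => ?_⟩
  set m := ∫ t in (0 : ℝ)..1, φ (edgePoint α θ i t) with hm
  set S := l2Norm T (fun x => fderiv ℝ φ x (1, 0)) + l2Norm T (fun x => fderiv ℝ φ x (0, 1))
    with hS
  have hS0 : 0 ≤ S := add_nonneg (Real.sqrt_nonneg _) (Real.sqrt_nonneg _)
  have hφ' := hφ.continuous_fderiv (n := (⊤ : ℕ∞)) (by simp)
  have hφc := hφ.continuous
  set N : ENNReal := ∫⁻ x in T, ‖fderiv ℝ φ x‖ₑ ^ 2 with hN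
  have hcont : Continuous fun y => fderiv ℝ φ y (y - P) := hφ'.clm_apply (by fun_prop)
  have hint : ∀ {f : ℝ × ℝ → ℝ}, Continuous f → Integrable f (volume.restrict T) := fun hf =>
    (memLp_of_continuous_of_isBounded (isBounded_triangleT α θ) hf).integrable (by norm_num)
  have hrep : ∀ x, α * Real.sin θ * (φ x - m)
      = ∫ y in T, (2 * (φ x - φ y) - fderiv ℝ φ y (y - P)) := by
    intro x
    have h1 := integral_edge hJ i hφ
    have h2 : ∫ y in T, (2 * (φ x - φ y) - fderiv ℝ φ y (y - P))
        = (∫ _ in T, 2 * φ x) - ∫ y in T, (fderiv ℝ φ y (y - P) + 2 * φ y) := by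
      rw [← integral_sub (g := fun y => fderiv ℝ φ y (y - P) + 2 * φ y) (hint continuous_const)
        (hint (hcont.add (hφc.const_mul 2)))]
      exact integral_congr_ae (Filter.Eventually.of_forall fun y => by simp only; ring)
    rw [h2, h1, setIntegral_const, smul_eq_mul, ← measure_triangleT hJ]
    ring
  have hpt : ∀ x, ENNReal.ofReal ((α * Real.sin θ * (φ x - m)) ^ 2)
      ≤ volume T * (8 * (∫⁻ y in T, ENNReal.ofReal ((φ x - φ y) ^ 2))
        + 2 * ENNReal.ofReal M ^ 2 * N) := by
    intro x
    rw [ofReal_sq_eq_enorm_sq, hrep x]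
    have h1 : ‖∫ y in T, (2 * (φ x - φ y) - fderiv ℝ φ y (y - P))‖ₑ ^ 2
        ≤ volume T * ∫⁻ y in T, ‖2 * (φ x - φ y) - fderiv ℝ φ y (y - P)‖ₑ ^ 2 := by
      have h2 := lintegral_mul_sq_le (μ := volume.restrict T) (f := fun _ => 1)
        (g := fun y => ‖2 * (φ x - φ y) - fderiv ℝ φ y (y - P)‖ₑ) aemeasurable_const
        (by fun_prop)
      simp only [one_mul, one_pow, lintegral_const, Measure.restrict_apply MeasurableSet.univ,
        Set.univ_inter] at h2
      exact (pow_le_pow_left₀ zero_le (enorm_integral_le_lintegral_enorm _) 2).trans h2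
    refine h1.trans ?_
    gcongr
    rw [← lintegral_const_mul _ (by fun_prop), hN, ← lintegral_const_mul _ (by fun_prop),
      ← lintegral_add_left (by fun_prop)]
    refine lintegral_mono_ae ((ae_restrict_iff' hTm).2 (Filter.Eventually.of_forall ?_))
    intro y hy
    have h3 : ‖fderiv ℝ φ y (y - P)‖ₑ ≤ ENNReal.ofReal M * ‖fderiv ℝ φ y‖ₑ := by
      rw [mul_comm]
      refine (ContinuousLinearMap.le_opENorm _ _).trans ?_
      gcongr
      exact hM2 y hy
    have h4 : ‖2 * (φ x - φ y) - fderiv ℝ φ y (y - P)‖ₑ ^ 2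
        ≤ 8 * ENNReal.ofReal ((φ x - φ y) ^ 2) + 2 * ‖fderiv ℝ φ y (y - P)‖ₑ ^ 2 := by
      rw [← ofReal_sq_eq_enorm_sq, ← ofReal_sq_eq_enorm_sq]
      rw [show (8 : ENNReal) = ENNReal.ofReal 8 by simp,
        show (2 : ENNReal) = ENNReal.ofReal 2 by simp, ← ENNReal.ofReal_mul (by norm_num),
        ← ENNReal.ofReal_mul (by norm_num), ← ENNReal.ofReal_add (by positivity) (by positivity)]
      refine ENNReal.ofReal_le_ofReal ?_
      nlinarith [sq_nonneg (2 * (φ x - φ y) + fderiv ℝ φ y (y - P))]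
    refine h4.trans ?_
    have h5 := pow_le_pow_left₀ zero_le h3 2
    rw [mul_pow] at h5
    rw [mul_assoc 2]
    gcongr
  have hosc := lintegral_lintegral_sub_sq_le hTm (convex_openTriangle _ _ _) hM1 hφ
  have htot : ∫⁻ x in T, ENNReal.ofReal ((α * Real.sin θ * (φ x - m)) ^ 2) ≤ E * N := by
    refine (lintegral_mono hpt).trans ?_
    have hmeas : Measurable fun x => ∫⁻ y in T, ENNReal.ofReal ((φ x - φ y) ^ 2) := by fun_prop
    rw [lintegral_const_mul _ (by fun_prop), lintegral_add_left (by fun_prop),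
      lintegral_const_mul _ hmeas, lintegral_const, Measure.restrict_apply MeasurableSet.univ,
      Set.univ_inter]
    calc _ ≤ volume T * (8 * (16 * ENNReal.ofReal M ^ 2 * volume T * N)
          + 2 * ENNReal.ofReal M ^ 2 * N * volume T) := by gcongr
      _ = E * N := by rw [hE]; ring
  have hNle : N ≤ ENNReal.ofReal (2 * S ^ 2) := lintegral_enorm_fderiv_sq_le hφ
  have hreal : ∫ x in T, (α * Real.sin θ * (φ x - m)) ^ 2 ≤ E.toReal * (2 * S ^ 2) := by
    have hI : Integrable (fun x => (α * Real.sin θ * (φ x - m)) ^ 2) (volume.restrict T) :=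
      hint (by fun_prop)
    rw [← ofReal_integral_eq_lintegral_ofReal hI
      (Filter.Eventually.of_forall fun x => sq_nonneg _)] at htot
    have h6 : ENNReal.ofReal (∫ x in T, (α * Real.sin θ * (φ x - m)) ^ 2)
        ≤ ENNReal.ofReal (E.toReal * (2 * S ^ 2)) := by
      rw [ENNReal.ofReal_mul ENNReal.toReal_nonneg, ENNReal.ofReal_toReal hEt]
      exact htot.trans (by gcongr)
    exact (ENNReal.ofReal_le_ofReal_iff (by positivity)).1 h6
  simp only [mul_pow] at hreal
  rw [integral_const_mul] at hreal
  rw [div_mul_eq_mul_div, le_div_iff₀ hJ]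
  refine abs_le_of_sq_le_sq' ?_ (by positivity) |>.2
  rw [mul_pow, mul_pow, mul_pow, Real.sq_sqrt (by positivity), l2Norm,
    Real.sq_sqrt (integral_nonneg fun _ => sq_nonneg _)]
  linarith

/-- The Poincaré inequality on functions with vanishing edge integral. -/
theorem exists_poincare (hJ : 0 < α * Real.sin θ) (i : Fin 3) :
    ∃ K : ℝ, 0 ≤ K ∧ ∀ v : ℝ × ℝ → ℝ, MemH1 (triangleT α θ) v → edgeFunctional α θ i v = 0 →
      l2Norm (triangleT α θ) v ≤ K * h1Semi (triangleT α θ) v := by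
  obtain ⟨K, hK0, hK⟩ := exists_poincare_of_contDiff hJ i
  -- Each of the two partial derivatives has norm at most |v|₁, whence the factor 2.
  refine ⟨2 * K, by positivity, fun v hv hzero => ?_⟩
  set T := triangleT α θ with hT
  have m1 : ((1, 0) : ℝ × ℝ) ∈ ({(1, 0), (0, 1)} : Set (ℝ × ℝ)) := by simp
  have m2 : ((0, 1) : ℝ × ℝ) ∈ ({(1, 0), (0, 1)} : Set (ℝ × ℝ)) := by simp
  have hd1 := (hv.isWeakDeriv m1).1
  have hd2 := (hv.isWeakDeriv m2).1
  obtain ⟨φ, hφ, h0, h1⟩ := exists_contDiff_tendsto (isOpen_triangleT hJ)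
    (convex_openTriangle _ _ _) (isBounded_triangleT α θ) (nonempty_openTriangle _ _ _) hv.1
  have h1' := fun e (he : e ∈ ({(1, 0), (0, 1)} : Set (ℝ × ℝ))) => h1 e _ (hv.isWeakDeriv he)
  -- The approximants need not have mean zero on the edge; it is enough that their means tend to
  -- zero.
  have hmean : Filter.Tendsto (fun n => ∫ t in (0 : ℝ)..1, φ n (edgePoint α θ i t))
      Filter.atTop (nhds 0) := by
    have h2 := (tendsto_edgeFunctional hJ i hv hφ h0 h1').const_mul (α * Real.sin θ)⁻¹
    rw [hzero, mul_zero] at h2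
    refine h2.congr fun n => ?_
    rw [inv_mul_cancel_left₀ hJ.ne']
  have hl0 := tendsto_sqrt_integral_sq_of_tendsto hv.1
    (fun n => memLp_triangleT_of_contDiff α θ (hφ n)) h0
  have hl1 := tendsto_sqrt_integral_sq_of_tendsto hd1
    (fun n => memLp_triangleT_fderiv α θ (hφ n) (1, 0)) (h1' _ m1)
  have hl2 := tendsto_sqrt_integral_sq_of_tendsto hd2
    (fun n => memLp_triangleT_fderiv α θ (hφ n) (0, 1)) (h1' _ m2)
  have hconst : ∀ c : ℝ, l2Norm T (fun _ => c) = |c| * l2Norm T (fun _ => 1) := by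
    intro c
    simp only [l2Norm, setIntegral_const, smul_eq_mul, one_pow, mul_one]
    rw [mul_comm, Real.sqrt_mul (sq_nonneg c), Real.sqrt_sq_eq_abs]
  have hle : ∀ n, l2Norm T (φ n)
      ≤ K * (l2Norm T (fun x => fderiv ℝ (φ n) x (1, 0))
          + l2Norm T (fun x => fderiv ℝ (φ n) x (0, 1)))
        + |∫ t in (0 : ℝ)..1, φ n (edgePoint α θ i t)| * l2Norm T (fun _ => 1) := by
    intro n
    rw [← hconst]
    set m := ∫ t in (0 : ℝ)..1, φ n (edgePoint α θ i t)
    refine le_trans ?_ (add_le_add (hK (φ n) (hφ n)) le_rfl)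
    have h3 := sqrt_integral_sq_add_le
      ((memLp_triangleT_of_contDiff α θ (hφ n)).sub (memLp_triangleT_const α θ m))
      (memLp_triangleT_const α θ m)
    simp only [Pi.sub_apply, sub_add_cancel] at h3
    exact h3
  have hlim := le_of_tendsto_of_tendsto' hl0
    (((hl1.add hl2).const_mul K).add (hmean.abs.mul_const (l2Norm T (fun _ => 1)))) hle
  simp only [abs_zero, zero_mul, add_zero] at hlim
  have hs1 : Real.sqrt (∫ x in T, weakDeriv T (1, 0) v x ^ 2) ≤ h1Semi T v := by
    refine Real.sqrt_le_sqrt (integral_mono hd1.integrable_sq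
      (hd1.integrable_sq.add hd2.integrable_sq) fun x => ?_)
    simp only
    linarith [sq_nonneg (weakDeriv T (0, 1) v x)]
  have hs2 : Real.sqrt (∫ x in T, weakDeriv T (0, 1) v x ^ 2) ≤ h1Semi T v := by
    refine Real.sqrt_le_sqrt (integral_mono hd2.integrable_sq
      (hd1.integrable_sq.add hd2.integrable_sq) fun x => ?_)
    simp only
    linarith [sq_nonneg (weakDeriv T (1, 0) v x)]
  refine hlim.trans ?_
  nlinarith

end Poincare

/-! ### The edge constants -/

section EdgeConst

variable {α θ : ℝ}

theorem edgeLength_zero (α θ : ℝ) : edgeLength α θ 0 = 1 := by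
  simp [edgeLength, edgeEnd, edgeStart, vertexA]

theorem edgeLength_one (hα : 0 < α) (θ : ℝ) : edgeLength α θ 1 = α := by
  have h : (α * Real.cos θ) ^ 2 + (α * Real.sin θ) ^ 2 = α ^ 2 := by
    rw [mul_pow, mul_pow, ← mul_add, Real.cos_sq_add_sin_sq, mul_one]
  simp [edgeLength, edgeEnd, edgeStart, vertexB, h, Real.sqrt_sq hα.le]

theorem edgeLength_pos (hα : 0 < α) (hs : 0 < Real.sin θ) (i : Fin 3) : 0 < edgeLength α θ i := by
  fin_cases i
  · exact (edgeLength_zero α θ).symm ▸ one_pos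
  · exact (edgeLength_one hα θ).symm ▸ hα
  · refine Real.sqrt_pos.2 ?_
    have : 0 < (α * Real.sin θ) ^ 2 := by positivity
    simp only [edgeEnd, edgeStart, vertexA, vertexB, Fin.reduceFinMk, Matrix.cons_val, sub_zero]
    positivity

theorem edgeNormal_zero (α θ : ℝ) : edgeNormal α θ 0 = (0, -1) := by
  rw [edgeNormal, edgeLength_zero]
  simp [edgeEnd, edgeStart, vertexA]

theorem edgeNormal_one (hα : 0 < α) (θ : ℝ) :
    edgeNormal α θ 1 = (-Real.sin θ, Real.cos θ) := by
  rw [edgeNormal, edgeLength_one hα]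
  ext <;> simp [edgeEnd, edgeStart, vertexB, hα.ne', neg_div]

theorem hasEdgeIntegral_zero_iff (hα : 0 < α) (hs : 0 < Real.sin θ) (i : Fin 3) {v : ℝ × ℝ → ℝ}
    (hv : MemH1 (triangleT α θ) v) :
    HasEdgeIntegral α θ i v 0 ↔ edgeFunctional α θ i v = 0 := by
  rw [hasEdgeIntegral_iff (mul_pos hα hs) i hv]
  simp [(edgeLength_pos hα hs i).ne', hα.ne', hs.ne']

theorem bddAbove_edgeQuotients (hα : 0 < α) (hs : 0 < Real.sin θ) (i : Fin 3) :
    BddAbove (edgeQuotients α θ i) := by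
  obtain ⟨K, hK0, hK⟩ := exists_poincare (mul_pos hα hs) i
  refine ⟨K, ?_⟩
  rintro r ⟨v, hv, hI, -, rfl⟩
  -- A quotient with zero seminorm has the default value 0 and is bounded too.
  exact div_le_of_le_mul₀ (Real.sqrt_nonneg _) hK0
    (hK v hv ((hasEdgeIntegral_zero_iff hα hs i hv).1 hI))

theorem edgeConst_nonneg (α θ : ℝ) (i : Fin 3) : 0 ≤ edgeConst α θ i := by
  refine Real.sSup_nonneg ?_
  rintro r ⟨v, -, -, -, rfl⟩
  exact div_nonneg (Real.sqrt_nonneg _) (Real.sqrt_nonneg _)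

theorem l2Norm_le_edgeConst_mul (hα : 0 < α) (hs : 0 < Real.sin θ) (i : Fin 3) {v : ℝ × ℝ → ℝ}
    (hv : MemH1 (triangleT α θ) v) (h0 : edgeFunctional α θ i v = 0) :
    l2Norm (triangleT α θ) v ≤ edgeConst α θ i * h1Semi (triangleT α θ) v := by
  have hsemi : 0 ≤ h1Semi (triangleT α θ) v := Real.sqrt_nonneg _
  by_cases hz : v =ᵐ[volume.restrict (triangleT α θ)] 0
  · rw [l2Norm_congr hz]
    simpa [l2Norm] using mul_nonneg (edgeConst_nonneg α θ i) hsemi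
  rcases hsemi.eq_or_lt with h1 | h1
  -- When |v|₁ = 0 the quotient carries no information, and the Poincaré inequality itself gives ‖v‖
  -- ≤ 0.
  · obtain ⟨K, -, hK⟩ := exists_poincare (mul_pos hα hs) i
    have h2 := hK v hv h0
    rwa [← h1, mul_zero] at h2 ⊢
  · rw [← div_le_iff₀ h1]
    exact le_csSup (bddAbove_edgeQuotients hα hs i)
      ⟨v, hv, (hasEdgeIntegral_zero_iff hα hs i hv).2 h0, hz, rfl⟩

end EdgeConst

/-! ### The interpolant -/

section Fortin

variable {α θ : ℝ}

theorem integral_edge_affine (α θ : ℝ) (i : Fin 3) (a b c : ℝ) :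
    ∫ t in (0 : ℝ)..1, (a + b * (edgePoint α θ i t).1 + c * (edgePoint α θ i t).2)
      = a + b * (((edgeStart α θ i).1 + (edgeEnd α θ i).1) / 2)
        + c * (((edgeStart α θ i).2 + (edgeEnd α θ i).2) / 2) := by
  have h : ∀ t : ℝ, a + b * (edgePoint α θ i t).1 + c * (edgePoint α θ i t).2
      = (a + b * (edgeStart α θ i).1 + c * (edgeStart α θ i).2)
        + (b * ((edgeEnd α θ i).1 - (edgeStart α θ i).1)
          + c * ((edgeEnd α θ i).2 - (edgeStart α θ i).2)) * t := by
    intro t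
    simp only [edgePoint, Prod.fst_add, Prod.snd_add, Prod.smul_fst, Prod.smul_snd, Prod.fst_sub,
      Prod.snd_sub, smul_eq_mul]
    ring
  simp only [h]
  rw [intervalIntegral.integral_add (by simp) (Continuous.intervalIntegrable (by fun_prop) _ _),
    intervalIntegral.integral_const_mul, integral_id]
  simp
  ring

theorem contDiff_affine (a b c : ℝ) :
    ContDiff ℝ (⊤ : ℕ∞) fun x : ℝ × ℝ => a + b * x.1 + c * x.2 := by
  fun_prop

theorem fderiv_affine (a b c : ℝ) (x y : ℝ × ℝ) :
    fderiv ℝ (fun x : ℝ × ℝ => a + b * x.1 + c * x.2) x y = b * y.1 + c * y.2 := by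
  have h1 : HasFDerivAt (fun x : ℝ × ℝ => x.1) (ContinuousLinearMap.fst ℝ ℝ ℝ) x := hasFDerivAt_fst
  have h2 : HasFDerivAt (fun x : ℝ × ℝ => x.2) (ContinuousLinearMap.snd ℝ ℝ ℝ) x := hasFDerivAt_snd
  have h : HasFDerivAt (fun x : ℝ × ℝ => a + b * x.1 + c * x.2) _ x :=
    ((h1.const_mul b).const_add a).add (h2.const_mul c)
  rw [h.fderiv]
  simp

theorem MemH1.affine_sub {v : ℝ × ℝ → ℝ} (hv : MemH1 (triangleT α θ) v) (a b c : ℝ) :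
    MemH1 (triangleT α θ) (fun x => a + b * x.1 + c * x.2 - v x) := by
  simpa [sub_eq_add_neg] using
    (memH1_of_contDiff (isBounded_triangleT α θ) (contDiff_affine a b c)).linear hv 1 (-1)

theorem MemH1.weakDeriv_affine_sub {v : ℝ × ℝ → ℝ} (hv : MemH1 (triangleT α θ) v)
    (a b c : ℝ) (hJ : 0 < α * Real.sin θ) {e : ℝ × ℝ}
    (he : e ∈ ({(1, 0), (0, 1)} : Set (ℝ × ℝ))) :
    weakDeriv (triangleT α θ) e (fun x => a + b * x.1 + c * x.2 - v x)
      =ᵐ[volume.restrict (triangleT α θ)]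
        fun x => b * e.1 + c * e.2 - weakDeriv (triangleT α θ) e v x := by
  have h := (isWeakDeriv_of_contDiff (isBounded_triangleT α θ) (contDiff_affine a b c) e).linear
    (memLp_triangleT_of_contDiff α θ (contDiff_affine a b c)) hv.1 (hv.isWeakDeriv he) 1 (-1)
  simp only [fderiv_affine, one_mul, neg_one_mul, ← sub_eq_add_neg] at h
  exact h.weakDeriv_ae_eq (isOpen_triangleT hJ)

theorem edgeFunctional_affine_sub {v : ℝ × ℝ → ℝ} (hv : MemH1 (triangleT α θ) v) (a b c : ℝ)
    (hJ : 0 < α * Real.sin θ) (i : Fin 3) :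
    edgeFunctional α θ i (fun x => a + b * x.1 + c * x.2 - v x)
      = α * Real.sin θ * (a + b * (((edgeStart α θ i).1 + (edgeEnd α θ i).1) / 2)
        + c * (((edgeStart α θ i).2 + (edgeEnd α θ i).2) / 2)) - edgeFunctional α θ i v := by
  have h := edgeFunctional_linear hJ i
    (memH1_of_contDiff (isBounded_triangleT α θ) (contDiff_affine a b c)) hv 1 (-1)
  rw [edgeFunctional_of_contDiff hJ i (contDiff_affine a b c), integral_edge_affine] at h
  simpa [sub_eq_add_neg] using h

/-- The edge length times the unit normal is the turned edge vector, so multiplying by the length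
removes the square roots and leaves equations linear in the coefficients. -/
theorem isFortinInterpolant_iff (hα : 0 < α) (hs : 0 < Real.sin θ) {q : ℝ × ℝ → ℝ × ℝ}
    (h1 : MemH1 (triangleT α θ) fun x => (q x).1) (h2 : MemH1 (triangleT α θ) fun x => (q x).2)
    (a : ℝ × ℝ × ℝ) :
    IsFortinInterpolant α θ q a ↔
      ∀ i, ((edgeEnd α θ i).2 - (edgeStart α θ i).2)
          * (α * Real.sin θ * (a.1 + a.2.2 * (((edgeStart α θ i).1 + (edgeEnd α θ i).1) / 2))
            - edgeFunctional α θ i fun x => (q x).1)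
        - ((edgeEnd α θ i).1 - (edgeStart α θ i).1)
          * (α * Real.sin θ * (a.2.1 + a.2.2 * (((edgeStart α θ i).2 + (edgeEnd α θ i).2) / 2))
            - edgeFunctional α θ i fun x => (q x).2) = 0 := by
  have hJ := mul_pos hα hs
  refine forall_congr' fun i => ?_
  have r1 := h1.affine_sub a.1 a.2.2 0
  have r2 := h2.affine_sub a.2.1 0 a.2.2
  have e : (fun x => ((rtField a x).1 - (q x).1) * (edgeNormal α θ i).1
      + ((rtField a x).2 - (q x).2) * (edgeNormal α θ i).2)
      = fun x => (edgeNormal α θ i).1 * (a.1 + a.2.2 * x.1 + 0 * x.2 - (q x).1)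
        + (edgeNormal α θ i).2 * (a.2.1 + 0 * x.1 + a.2.2 * x.2 - (q x).2) := by
    funext x
    simp only [rtField]
    ring
  have hL := (edgeLength_pos hα hs i).ne'
  rw [e, hasEdgeIntegral_zero_iff hα hs i (r1.linear r2 _ _), edgeFunctional_linear hJ i r1 r2,
    edgeFunctional_affine_sub h1 _ _ _ hJ, edgeFunctional_affine_sub h2 _ _ _ hJ]
  simp only [edgeNormal]
  rw [← mul_right_inj' hL, mul_zero]
  refine Eq.congr ?_ rfl
  field_simp
  ring

/-- The lines of e₁ and e₂ pass through the origin, where x·n vanishes identically. So a₃ occurs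
only in the third equation and the system is triangular. -/
theorem isFortinInterpolant_iff_coord (hα : 0 < α) (hs : 0 < Real.sin θ) {q : ℝ × ℝ → ℝ × ℝ}
    (h1 : MemH1 (triangleT α θ) fun x => (q x).1) (h2 : MemH1 (triangleT α θ) fun x => (q x).2)
    (a : ℝ × ℝ × ℝ) :
    IsFortinInterpolant α θ q a ↔
      α * Real.sin θ * a.2.1 = edgeFunctional α θ 0 (fun x => (q x).2) ∧
      α * Real.sin θ * (-(α * Real.sin θ) * a.1 + α * Real.cos θ * a.2.1)
        = -(α * Real.sin θ) * edgeFunctional α θ 1 (fun x => (q x).1)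
          + α * Real.cos θ * edgeFunctional α θ 1 (fun x => (q x).2) ∧
      α * Real.sin θ * (α * Real.sin θ * a.1 + (1 - α * Real.cos θ) * a.2.1
          + α * Real.sin θ * a.2.2)
        = α * Real.sin θ * edgeFunctional α θ 2 (fun x => (q x).1)
          + (1 - α * Real.cos θ) * edgeFunctional α θ 2 (fun x => (q x).2) := by
  rw [isFortinInterpolant_iff hα hs h1 h2, Fin.forall_fin_succ, Fin.forall_fin_succ,
    Fin.forall_fin_one]
  simp only [edgeEnd, edgeStart, vertexA, vertexB, Fin.succ_zero_eq_one, Fin.succ_one_eq_two,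
    Matrix.cons_val, Prod.fst_zero, Prod.snd_zero]
  refine and_congr ?_ (and_congr ?_ ?_)
  · constructor <;> intro h <;> linear_combination -h
  · constructor <;> intro h <;> linear_combination h
  · constructor <;> intro h <;> linear_combination h

theorem existsUnique_isFortinInterpolant (hα : 0 < α) (hs : 0 < Real.sin θ)
    {q : ℝ × ℝ → ℝ × ℝ} (h1 : MemH1 (triangleT α θ) fun x => (q x).1)
    (h2 : MemH1 (triangleT α θ) fun x => (q x).2) :
    ∃! a : ℝ × ℝ × ℝ, IsFortinInterpolant α θ q a := by
  simp only [isFortinInterpolant_iff_coord hα hs h1 h2]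
  have hJ : α * Real.sin θ ≠ 0 := (mul_pos hα hs).ne'
  set J := α * Real.sin θ
  set m₁ := edgeFunctional α θ 0 (fun x => (q x).2)
  set m₂ := -J * edgeFunctional α θ 1 (fun x => (q x).1)
    + α * Real.cos θ * edgeFunctional α θ 1 (fun x => (q x).2)
  set m₃ := J * edgeFunctional α θ 2 (fun x => (q x).1)
    + (1 - α * Real.cos θ) * edgeFunctional α θ 2 (fun x => (q x).2)
  -- Back substitution: the equation on e₁ gives a₂, the one on e₂ then a₁, the one on e₃ then a₃.
  refine ⟨((α * Real.cos θ * m₁ - m₂) / J ^ 2, m₁ / J,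
    (m₃ - (α * Real.cos θ * m₁ - m₂) - (1 - α * Real.cos θ) * m₁) / J ^ 2), ?_, ?_⟩
  · refine ⟨?_, ?_, ?_⟩
    · simp only
      field_simp
    · simp only
      field_simp
      ring
    · simp only
      field_simp
      ring
  · rintro ⟨a, b, c⟩ ⟨e1, e2, e3⟩
    simp only at e1 e2 e3
    refine Prod.ext ?_ (Prod.ext ?_ ?_)
    · simp only
      rw [eq_div_iff (pow_ne_zero 2 hJ)]
      linear_combination α * Real.cos θ * e1 - e2
    · simp only
      rw [eq_div_iff hJ]
      linear_combination e1
    · simp only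
      rw [eq_div_iff (pow_ne_zero 2 hJ)]
      linear_combination e3 + e2 - e1

/-- The apex of e₃ is the origin, so the functionals of two edges differ only by constants times the
integrals of the partial derivatives. -/
theorem edgeFunctional_eq (i : Fin 3) {v : ℝ × ℝ → ℝ} (hv : MemH1 (triangleT α θ) v) :
    edgeFunctional α θ i v = edgeFunctional α θ 2 v
      - (edgeApex α θ i).1 * (∫ x in triangleT α θ, weakDeriv (triangleT α θ) (1, 0) v x)
      - (edgeApex α θ i).2 * ∫ x in triangleT α θ, weakDeriv (triangleT α θ) (0, 1) v x := by
  have key : ∀ {f k : ℝ × ℝ → ℝ} (c : ℝ), MemLp f 2 (volume.restrict (triangleT α θ)) →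
      MemLp k 2 (volume.restrict (triangleT α θ)) →
      ∫ x in triangleT α θ, (f x - c) * k x
        = (∫ x in triangleT α θ, f x * k x) - c * ∫ x in triangleT α θ, k x := by
    intro f k c hf hk
    have hk1 : Integrable k (volume.restrict (triangleT α θ)) := by
      have h := (memLp_triangleT_const α θ 1).integrable_mul hk
      exact h.congr (Filter.Eventually.of_forall fun x => one_mul (k x))
    rw [← integral_const_mul, ← integral_sub (f := fun x => f x * k x) (hf.integrable_mul hk)
      (hk1.const_mul c)]
    exact integral_congr_ae (Filter.Eventually.of_forall fun x => by simp only; ring)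
  have hd1 := (hv.isWeakDeriv (e := (1, 0)) (by simp)).1
  have hd2 := (hv.isWeakDeriv (e := (0, 1)) (by simp)).1
  have hx1 : MemLp (fun x : ℝ × ℝ => x.1) 2 (volume.restrict (triangleT α θ)) :=
    memLp_of_continuous_of_isBounded (isBounded_triangleT α θ) continuous_fst
  have hx2 : MemLp (fun x : ℝ × ℝ => x.2) 2 (volume.restrict (triangleT α θ)) :=
    memLp_of_continuous_of_isBounded (isBounded_triangleT α θ) continuous_snd
  simp only [edgeFunctional]
  rw [key _ hx1 hd1, key _ hx2 hd2, key _ hx1 hd1, key _ hx2 hd2]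
  simp only [edgeApex, Matrix.cons_val, Prod.fst_zero, Prod.snd_zero]
  ring

/-- The divergence of the interpolant is the mean of the divergence of the field. -/
theorem IsFortinInterpolant.divergence_eq (hα : 0 < α) (hs : 0 < Real.sin θ)
    {q : ℝ × ℝ → ℝ × ℝ} (h1 : MemH1 (triangleT α θ) fun x => (q x).1)
    (h2 : MemH1 (triangleT α θ) fun x => (q x).2) {a : ℝ × ℝ × ℝ}
    (h : IsFortinInterpolant α θ q a) :
    α * Real.sin θ * a.2.2
      = (∫ x in triangleT α θ, weakDeriv (triangleT α θ) (1, 0) (fun x => (q x).1) x)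
        + ∫ x in triangleT α θ, weakDeriv (triangleT α θ) (0, 1) (fun x => (q x).2) x := by
  obtain ⟨e1, e2, e3⟩ := (isFortinInterpolant_iff_coord hα hs h1 h2 a).1 h
  rw [edgeFunctional_eq 0 h2] at e1
  rw [edgeFunctional_eq 1 h1, edgeFunctional_eq 1 h2] at e2
  simp only [edgeApex, vertexA, vertexB, Matrix.cons_val] at e1 e2
  have hJ : α * Real.sin θ ≠ 0 := (mul_pos hα hs).ne'
  refine mul_left_cancel₀ hJ ?_
  -- Sum of the three fluxes. The edge vectors add up to zero, so the functionals on e₃ cancel and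
  -- only the integral of the divergence survives.
  linear_combination e3 + e2 - e1

/-! ### The eigenvalue problem behind the constant. -/

/-- The value `c6Expr c₁ c₂ θ ^ 2` is the largest eigenvalue of the quadratic form
`c₁² a² + c₂² b² + 2 |cos θ| c₁ c₂ a b` relative to `a² + b² - 2 |cos θ| a b`. -/
theorem form_le_c6Expr_sq_mul {c₁ c₂ a b k : ℝ} (h₁ : 0 ≤ c₁) (h₂ : 0 ≤ c₂)
    (hs : 0 < Real.sin θ) (hk : 0 ≤ k) (hkc : k ^ 2 = Real.cos θ ^ 2) :
    (c₁ * a) ^ 2 + (c₂ * b) ^ 2 + 2 * k * ((c₁ * a) * (c₂ * b))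
      ≤ c6Expr c₁ c₂ θ ^ 2 * (a ^ 2 + b ^ 2 - 2 * k * (a * b)) := by
  have hsc : Real.sin θ ^ 2 = 1 - k ^ 2 := by rw [hkc]; linarith [Real.sin_sq_add_cos_sq θ]
  set s := Real.sin θ with hs_def
  set S := c₁ ^ 2 + c₂ ^ 2 + 2 * c₁ * c₂ * Real.cos θ ^ 2 with hS
  set Q := c₁ ^ 2 + c₂ ^ 2 + 2 * c₁ * c₂ * Real.cos (2 * θ) with hQ
  have hc12 := mul_nonneg h₁ h₂
  have hQ' : Q = c₁ ^ 2 + c₂ ^ 2 + 2 * c₁ * c₂ * (2 * k ^ 2 - 1) := by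
    rw [hQ, Real.cos_two_mul, hkc]
  have hQ0 : 0 ≤ Q := by
    rw [hQ']
    nlinarith [sq_nonneg (c₁ - c₂), mul_nonneg hc12 (sq_nonneg k)]
  have hS' : S = c₁ ^ 2 + c₂ ^ 2 + 2 * c₁ * c₂ * k ^ 2 := by rw [hS, hkc]
  have hS0 : c₁ ^ 2 + c₂ ^ 2 ≤ S := by
    rw [hS']
    nlinarith [mul_nonneg hc12 (sq_nonneg k)]
  have hR0 : 0 ≤ (c₁ + c₂) * Real.sqrt Q := by positivity
  -- This is the discriminant of s²λ² - Sλ + s²c₁²c₂², so l = (S + R) / (2s²) is its larger root.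
  have hRsq : ((c₁ + c₂) * Real.sqrt Q) ^ 2 = S ^ 2 - 4 * (s ^ 2) ^ 2 * c₁ ^ 2 * c₂ ^ 2 := by
    rw [mul_pow, Real.sq_sqrt hQ0, hQ', hS', hsc]
    ring
  set R := (c₁ + c₂) * Real.sqrt Q with hR
  set l := c6Expr c₁ c₂ θ ^ 2 with hl
  have hl2 : 2 * s ^ 2 * l = S + R := by
    rw [hl, c6Expr, ← hs_def, div_pow, mul_pow, Real.sq_sqrt (by positivity),
      Real.sq_sqrt (by nlinarith [sq_nonneg c₁, sq_nonneg c₂])]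
    field_simp
    rfl
  have hs2 : 0 < s ^ 2 := by positivity
  have hl0 : 0 ≤ l := sq_nonneg _
  have hchar : s ^ 2 * l ^ 2 - S * l + s ^ 2 * c₁ ^ 2 * c₂ ^ 2 = 0 := by
    have h3 : (2 * s ^ 2 * l - S) ^ 2 = S ^ 2 - 4 * (s ^ 2) ^ 2 * c₁ ^ 2 * c₂ ^ 2 := by
      rw [← hRsq, hl2]
      ring
    have h4 : s ^ 2 * (s ^ 2 * l ^ 2 - S * l + s ^ 2 * c₁ ^ 2 * c₂ ^ 2) = 0 := by
      linear_combination h3 / 4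
    exact (mul_eq_zero.1 h4).resolve_left hs2.ne'
  -- The determinant of the difference of the two forms at λ = l vanishes. Together with the
  -- nonnegative trace below, this makes both diagonal entries nonnegative and the difference a
  -- perfect square.
  have hprod : (l - c₁ ^ 2) * (l - c₂ ^ 2) = (k * (l + c₁ * c₂)) ^ 2 := by
    rw [hsc, hS'] at hchar
    linear_combination hchar
  have hsum : 0 ≤ (l - c₁ ^ 2) + (l - c₂ ^ 2) := by
    have h5 : s ^ 2 ≤ 1 := by rw [hsc]; linarith [sq_nonneg k]
    nlinarith [mul_le_mul_of_nonneg_right h5 hl0]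
  have hA : 0 ≤ l - c₁ ^ 2 := by
    by_contra hcon
    push Not at hcon
    nlinarith [sq_nonneg (k * (l + c₁ * c₂)), sq_nonneg (l - c₁ ^ 2)]
  have hB : 0 ≤ l - c₂ ^ 2 := by
    by_contra hcon
    push Not at hcon
    nlinarith [sq_nonneg (k * (l + c₁ * c₂)), sq_nonneg (l - c₂ ^ 2)]
  have hC : Real.sqrt (l - c₁ ^ 2) * Real.sqrt (l - c₂ ^ 2) = k * (l + c₁ * c₂) := by
    rw [← Real.sqrt_mul hA, hprod, Real.sqrt_sq (by positivity)]
  have hsq := sq_nonneg (Real.sqrt (l - c₁ ^ 2) * a - Real.sqrt (l - c₂ ^ 2) * b)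
  have hexp : (Real.sqrt (l - c₁ ^ 2) * a - Real.sqrt (l - c₂ ^ 2) * b) ^ 2
      = (l - c₁ ^ 2) * a ^ 2 + (l - c₂ ^ 2) * b ^ 2 - 2 * (k * (l + c₁ * c₂)) * (a * b) := by
    linear_combination a ^ 2 * Real.sq_sqrt hA + b ^ 2 * Real.sq_sqrt hB - 2 * a * b * hC
  rw [hexp] at hsq
  linarith

end Fortin

/-! ### The error estimate -/

section Estimate

variable {α θ : ℝ}

/-- The integrated Gram identity for n₁ = (0, -1) and n₂ = (-sin θ, cos θ). It is used for the field
and for each of its partial derivatives. -/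
theorem integral_normal_components {X : Type*} [MeasurableSpace X] {μ : Measure X} {f g : X → ℝ}
    (hf : MemLp f 2 μ) (hg : MemLp g 2 μ) (θ : ℝ) :
    Real.sin θ ^ 2 * ((∫ x, f x ^ 2 ∂μ) + ∫ x, g x ^ 2 ∂μ)
      = (∫ x, (0 * f x + -1 * g x) ^ 2 ∂μ)
        + (∫ x, (-Real.sin θ * f x + Real.cos θ * g x) ^ 2 ∂μ)
        + ∫ x, 2 * Real.cos θ * ((0 * f x + -1 * g x)
          * (-Real.sin θ * f x + Real.cos θ * g x)) ∂μ := by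
  have hu : MemLp (fun x => 0 * f x + -1 * g x) 2 μ := (hf.const_mul 0).add (hg.const_mul (-1))
  have hw : MemLp (fun x => -Real.sin θ * f x + Real.cos θ * g x) 2 μ :=
    (hf.const_mul (-Real.sin θ)).add (hg.const_mul (Real.cos θ))
  rw [← integral_add hf.integrable_sq hg.integrable_sq, ← integral_const_mul,
    ← integral_add_three (h := fun x => 2 * Real.cos θ * ((0 * f x + -1 * g x)
        * (-Real.sin θ * f x + Real.cos θ * g x))) hu.integrable_sq hw.integrable_sq
      ((hu.integrable_mul hw).const_mul (2 * Real.cos θ))]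
  refine integral_congr_ae (Filter.Eventually.of_forall fun x => ?_)
  simp only
  linear_combination (g x ^ 2) * Real.sin_sq_add_cos_sq θ

theorem h1Semi_sq {U : Set (ℝ × ℝ)} {v : ℝ × ℝ → ℝ} (hv : MemH1 U v) :
    h1Semi U v ^ 2
      = (∫ x in U, weakDeriv U (1, 0) v x ^ 2) + ∫ x in U, weakDeriv U (0, 1) v x ^ 2 := by
  have hd1 := (hv.isWeakDeriv (e := (1, 0)) (by simp)).1
  have hd2 := (hv.isWeakDeriv (e := (0, 1)) (by simp)).1
  rw [h1Semi, Real.sq_sqrt (integral_nonneg fun _ => by positivity),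
    integral_add hd1.integrable_sq hd2.integrable_sq]

theorem l2Norm_sq (U : Set (ℝ × ℝ)) (f : ℝ × ℝ → ℝ) : l2Norm U f ^ 2 = ∫ x in U, f x ^ 2 :=
  Real.sq_sqrt (integral_nonneg fun _ => sq_nonneg _)

/-- The `L²` estimate for a field whose normal components on `e₁` and `e₂` have mean zero there. -/
theorem l2_sq_le_c6_sq_mul (hα : 0 < α) (hs : 0 < Real.sin θ) {r₁ r₂ : ℝ × ℝ → ℝ}
    (h₁ : MemH1 (triangleT α θ) r₁) (h₂ : MemH1 (triangleT α θ) r₂)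
    (hu0 : edgeFunctional α θ 0 (fun x => 0 * r₁ x + -1 * r₂ x) = 0)
    (hw0 : edgeFunctional α θ 1 (fun x => -Real.sin θ * r₁ x + Real.cos θ * r₂ x) = 0) :
    (∫ x in triangleT α θ, r₁ x ^ 2) + (∫ x in triangleT α θ, r₂ x ^ 2)
      ≤ constC6 α θ ^ 2 * (h1Semi (triangleT α θ) r₁ ^ 2 + h1Semi (triangleT α θ) r₂ ^ 2) := by
  have hJ := mul_pos hα hs
  have hopen := isOpen_triangleT hJ
  set T := triangleT α θ with hT
  set u : ℝ × ℝ → ℝ := fun x => 0 * r₁ x + -1 * r₂ x with hu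
  set w : ℝ × ℝ → ℝ := fun x => -Real.sin θ * r₁ x + Real.cos θ * r₂ x with hw
  have hu1 : MemH1 T u := h₁.linear h₂ 0 (-1)
  have hw1 : MemH1 T w := h₁.linear h₂ _ _
  have pu := l2Norm_le_edgeConst_mul hα hs 0 hu1 hu0
  have pw := l2Norm_le_edgeConst_mul hα hs 1 hw1 hw0
  have hc0 := edgeConst_nonneg α θ 0
  have hc1 := edgeConst_nonneg α θ 1
  set c₁ := edgeConst α θ 0 with hc₁
  set c₂ := edgeConst α θ 1 with hc₂
  set a := h1Semi T u with ha
  set b := h1Semi T w with hb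
  have ha0 : 0 ≤ a := Real.sqrt_nonneg _
  have hb0 : 0 ≤ b := Real.sqrt_nonneg _
  -- The angle may be acute or obtuse, so the cross terms are bounded in absolute value.
  set k := |Real.cos θ| with hk
  have hk0 : 0 ≤ k := abs_nonneg _
  have hform := form_le_c6Expr_sq_mul (θ := θ) (a := a) (b := b) (k := k) hc0 hc1 hs hk0 (sq_abs _)
  have hcross : ∀ {f g : ℝ × ℝ → ℝ}, MemLp f 2 (volume.restrict T) →
      MemLp g 2 (volume.restrict T) →
      |∫ x in T, 2 * Real.cos θ * (f x * g x)| ≤ 2 * k * (l2Norm T f * l2Norm T g) := by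
    intro f g hf hg
    rw [integral_const_mul, abs_mul, abs_mul, abs_two]
    exact mul_le_mul_of_nonneg_left (abs_integral_mul_le_sqrt hf hg) (by positivity)
  have nu : 0 ≤ l2Norm T u := Real.sqrt_nonneg _
  have nw : 0 ≤ l2Norm T w := Real.sqrt_nonneg _
  have hL : Real.sin θ ^ 2 * ((∫ x in T, r₁ x ^ 2) + ∫ x in T, r₂ x ^ 2)
      ≤ (c₁ * a) ^ 2 + (c₂ * b) ^ 2 + 2 * k * ((c₁ * a) * (c₂ * b)) := by
    rw [integral_normal_components h₁.1 h₂.1 θ]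
    have e1 := l2Norm_sq T u
    have e2 := l2Norm_sq T w
    have e3 := (le_abs_self _).trans (hcross hu1.1 hw1.1)
    rw [← e1, ← e2]
    refine add_le_add_three (pow_le_pow_left₀ nu pu 2) (pow_le_pow_left₀ nw pw 2) (e3.trans ?_)
    gcongr
  have hG : a ^ 2 + b ^ 2 - 2 * k * (a * b)
      ≤ Real.sin θ ^ 2 * (h1Semi T r₁ ^ 2 + h1Semi T r₂ ^ 2) := by
    have key : ∀ e ∈ ({(1, 0), (0, 1)} : Set (ℝ × ℝ)),
        l2Norm T (weakDeriv T e u) ^ 2 + l2Norm T (weakDeriv T e w) ^ 2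
          - 2 * k * (l2Norm T (weakDeriv T e u) * l2Norm T (weakDeriv T e w))
        ≤ Real.sin θ ^ 2
          * ((∫ x in T, weakDeriv T e r₁ x ^ 2) + ∫ x in T, weakDeriv T e r₂ x ^ 2) := by
      intro e he
      have hd1 := (h₁.isWeakDeriv he).1
      have hd2 := (h₂.isWeakDeriv he).1
      have eu := h₁.weakDeriv_linear hopen h₂ he 0 (-1)
      have ew := h₁.weakDeriv_linear hopen h₂ he (-Real.sin θ) (Real.cos θ)
      rw [l2Norm_congr eu, l2Norm_congr ew, integral_normal_components hd1 hd2 θ, l2Norm_sq,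
        l2Norm_sq]
      have e3 := neg_le_of_abs_le (hcross ((hd1.const_mul 0).add (hd2.const_mul (-1)))
        ((hd1.const_mul (-Real.sin θ)).add (hd2.const_mul (Real.cos θ))))
      simp only [Pi.add_apply] at e3
      have e4 : ∀ f g : ℝ × ℝ → ℝ, (f + g) = fun x => f x + g x := fun _ _ => rfl
      simp only [e4] at e3
      linarith
    have k1 := key (1, 0) (by simp)
    have k2 := key (0, 1) (by simp)
    have ea : a ^ 2 = _ := h1Semi_sq hu1
    have eb : b ^ 2 = _ := h1Semi_sq hw1
    rw [h1Semi_sq h₁, h1Semi_sq h₂]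
    rw [← l2Norm_sq, ← l2Norm_sq] at ea eb
    set a₁ := l2Norm T (weakDeriv T (1, 0) u)
    set a₂ := l2Norm T (weakDeriv T (0, 1) u)
    set b₁ := l2Norm T (weakDeriv T (1, 0) w)
    set b₂ := l2Norm T (weakDeriv T (0, 1) w)
    -- Cauchy–Schwarz in ℝ² recombines the bounds for the two partial derivatives.
    have hab : a₁ * b₁ + a₂ * b₂ ≤ a * b := by
      refine (abs_le_of_sq_le_sq' ?_ (by positivity)).2
      rw [mul_pow, ea, eb]
      nlinarith [sq_nonneg (a₁ * b₂ - a₂ * b₁)]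
    nlinarith [mul_le_mul_of_nonneg_left hab hk0]
  have hs2 : 0 < Real.sin θ ^ 2 := by positivity
  refine le_of_mul_le_mul_left ?_ hs2
  calc _ ≤ _ := hL
    _ ≤ _ := hform
    _ ≤ c6Expr c₁ c₂ θ ^ 2 * (Real.sin θ ^ 2 * (h1Semi T r₁ ^ 2 + h1Semi T r₂ ^ 2)) :=
        mul_le_mul_of_nonneg_left hG (sq_nonneg _)
    _ = _ := by
        rw [constC6]
        ring

theorem integral_const_sub_sq {f : ℝ × ℝ → ℝ}
    (hf : MemLp f 2 (volume.restrict (triangleT α θ))) (c : ℝ) :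
    ∫ x in triangleT α θ, (c - f x) ^ 2
      = volume.real (triangleT α θ) * c ^ 2 - 2 * c * (∫ x in triangleT α θ, f x)
        + ∫ x in triangleT α θ, f x ^ 2 := by
  have hf1 : Integrable f (volume.restrict (triangleT α θ)) :=
    ((memLp_triangleT_const α θ 1).integrable_mul hf).congr
      (Filter.Eventually.of_forall fun x => one_mul (f x))
  have hc : Integrable (fun _ : ℝ × ℝ => c ^ 2) (volume.restrict (triangleT α θ)) :=
    (memLp_triangleT_const α θ c).integrable_sq
  have h := integral_add_three hc (hf1.const_mul (-(2 * c))) hf.integrable_sq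
  rw [setIntegral_const, integral_const_mul, smul_eq_mul] at h
  rw [show volume.real (triangleT α θ) * c ^ 2 - 2 * c * (∫ x in triangleT α θ, f x)
      + ∫ x in triangleT α θ, f x ^ 2 = volume.real (triangleT α θ) * c ^ 2
        + -(2 * c) * (∫ x in triangleT α θ, f x) + ∫ x in triangleT α θ, f x ^ 2 by ring, ← h]
  exact integral_congr_ae (Filter.Eventually.of_forall fun x => by simp only; ring)

/-- Subtracting the interpolant does not increase the `H¹` seminorm. -/
theorem IsFortinInterpolant.h1Semi_sq_le (hα : 0 < α) (hs : 0 < Real.sin θ)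
    {q : ℝ × ℝ → ℝ × ℝ} (h1 : MemH1 (triangleT α θ) fun x => (q x).1)
    (h2 : MemH1 (triangleT α θ) fun x => (q x).2) {a : ℝ × ℝ × ℝ}
    (h : IsFortinInterpolant α θ q a) :
    h1Semi (triangleT α θ) (fun x => a.1 + a.2.2 * x.1 + 0 * x.2 - (q x).1) ^ 2
      + h1Semi (triangleT α θ) (fun x => a.2.1 + 0 * x.1 + a.2.2 * x.2 - (q x).2) ^ 2
      ≤ h1Semi (triangleT α θ) (fun x => (q x).1) ^ 2
        + h1Semi (triangleT α θ) (fun x => (q x).2) ^ 2 := by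
  have hJ := mul_pos hα hs
  have hdiv := h.divergence_eq hα hs h1 h2
  have hvol := measure_triangleT hJ
  set T := triangleT α θ with hT
  have key : ∀ {v : ℝ × ℝ → ℝ} (_ : MemH1 T v) (a b c : ℝ) (e : ℝ × ℝ)
      (_ : e ∈ ({(1, 0), (0, 1)} : Set (ℝ × ℝ))),
      ∫ x in T, weakDeriv T e (fun x => a + b * x.1 + c * x.2 - v x) x ^ 2
        = volume.real T * (b * e.1 + c * e.2) ^ 2
          - 2 * (b * e.1 + c * e.2) * (∫ x in T, weakDeriv T e v x)
          + ∫ x in T, weakDeriv T e v x ^ 2 := by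
    intro v hv a b c e he
    rw [← integral_const_sub_sq (hv.isWeakDeriv he).1]
    exact integral_congr_ae ((hv.weakDeriv_affine_sub a b c hJ he).mono fun x hx =>
      congrArg (· ^ 2) hx)
  rw [h1Semi_sq (h1.affine_sub _ _ _), h1Semi_sq (h2.affine_sub _ _ _), h1Semi_sq h1,
    h1Semi_sq h2, key h1 _ _ _ (1, 0) (by simp), key h1 _ _ _ (0, 1) (by simp),
    key h2 _ _ _ (1, 0) (by simp), key h2 _ _ _ (0, 1) (by simp)]
  have hfin : 0 ≤ α * Real.sin θ * a.2.2 ^ 2 := by positivity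
  rw [← hvol] at hfin hdiv
  simp only
  -- The squares contribute 2|T|a₃² and the cross terms -2a₃∫div q = -4|T|a₃², so the left side
  -- falls short of the right by 2|T|a₃².
  nlinarith [congrArg (a.2.2 * ·) hdiv]

theorem IsFortinInterpolant.l2NormVec_le (hα : 0 < α) (hs : 0 < Real.sin θ)
    {q : ℝ × ℝ → ℝ × ℝ} (h1 : MemH1 (triangleT α θ) fun x => (q x).1)
    (h2 : MemH1 (triangleT α θ) fun x => (q x).2) {a : ℝ × ℝ × ℝ}
    (h : IsFortinInterpolant α θ q a) :
    l2NormVec (triangleT α θ) (fun x => q x - rtField a x)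
      ≤ constC6 α θ * h1SemiVec (triangleT α θ) q := by
  have r1 := h1.affine_sub a.1 a.2.2 0
  have r2 := h2.affine_sub a.2.1 0 a.2.2
  have hedge : ∀ i, edgeFunctional α θ i (fun x =>
      (edgeNormal α θ i).1 * (a.1 + a.2.2 * x.1 + 0 * x.2 - (q x).1)
        + (edgeNormal α θ i).2 * (a.2.1 + 0 * x.1 + a.2.2 * x.2 - (q x).2)) = 0 := by
    intro i
    rw [← hasEdgeIntegral_zero_iff hα hs i (r1.linear r2 _ _)]
    convert h i using 2 with x
    simp only [rtField]
    ring
  have hu := hedge 0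
  have hw := hedge 1
  rw [edgeNormal_zero] at hu
  rw [edgeNormal_one hα] at hw
  have hmain := (l2_sq_le_c6_sq_mul hα hs r1 r2 hu hw).trans
    (mul_le_mul_of_nonneg_left (h.h1Semi_sq_le hα hs h1 h2) (sq_nonneg _))
  have hC0 : 0 ≤ constC6 α θ := div_nonneg (Real.sqrt_nonneg _) (by positivity)
  have hq0 : 0 ≤ h1SemiVec (triangleT α θ) q := Real.sqrt_nonneg _
  refine Real.sqrt_le_iff.2 ⟨mul_nonneg hC0 hq0, ?_⟩
  rw [mul_pow, h1SemiVec, Real.sq_sqrt (by positivity)]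
  refine le_trans (le_of_eq ?_) hmain
  rw [← integral_add r1.1.integrable_sq r2.1.integrable_sq]
  refine integral_congr_ae (Filter.Eventually.of_forall fun x => ?_)
  simp only [rtField, Prod.fst_sub, Prod.snd_sub]
  ring

end Estimate

theorem theorem2 (α θ : ℝ) (hα : 0 < α) (hα1 : α ≤ 1) (hθ : Real.arccos (α / 2) ≤ θ)
    (hθπ : θ < Real.pi) :
    (BddAbove (edgeQuotients α θ 0) ∧ BddAbove (edgeQuotients α θ 1)) ∧
    ∀ q : ℝ × ℝ → ℝ × ℝ,
      MemH1 (triangleT α θ) (fun x => (q x).1) → MemH1 (triangleT α θ) (fun x => (q x).2) →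
      (∃! a : ℝ × ℝ × ℝ, IsFortinInterpolant α θ q a) ∧
      ∀ a : ℝ × ℝ × ℝ, IsFortinInterpolant α θ q a →
        l2NormVec (triangleT α θ) (fun x => q x - rtField a x)
          ≤ constC6 α θ * h1SemiVec (triangleT α θ) q := by
  -- The lower bound on θ enters through arccos(α/2) > 0, which holds since α/2 < 1.
  have hs : 0 < Real.sin θ :=
    Real.sin_pos_of_pos_of_lt_pi ((Real.arccos_pos.2 (by linarith)).trans_le hθ) hθπ
  exact ⟨⟨bddAbove_edgeQuotients hα hs 0, bddAbove_edgeQuotients hα hs 1⟩, fun q h1 h2 =>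
    ⟨existsUnique_isFortinInterpolant hα hs h1 h2, fun a ha => ha.l2NormVec_le hα hs h1 h2⟩⟩
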